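/- **Setting.** A Grassmann algebra is $A=\Lambda\mathbb R^n$ with even part $A_0$ and odd part $A_1$; homomorphisms of Grassmann algebras preserve the grading. For a finite-dimensional real super vector space $V=V_0\oplus V_1$ put $V_A=(A\otimes V)_0=A_0\otimes V_0\oplus A_1\otimes V_1$. A map between open subsets of finite-dimensional $A_0$-modules is *$A_0$-smooth* if it is $C^\infty$ with $A_0$-linear derivative at every point. A supermanifold is a functor $M\colon A\mapsto M_A$ from Grassmann algebras to manifolds with an atlas of superdomains in some $V$ and smooth transition maps; a smooth map of supermanifolds is a natural family of $A_0$-smooth maps; a Lie supergroup is a group object among supermanifolds. Let $\mathfrak h$ be a finite-dimensional nilpotent Lie superalgebra. The bracket of $\mathfrak h$ makes each $\mathfrak h_A$ a nilpotent Lie algebra by $[aX,bY]_A=ba[X,Y]$. The exponential supergroup $H$ has $H_A=\mathfrak h_A$ (with $\exp_A$ the identity map) and the Baker–Campbell–Hausdorff multiplication. Fix a smoothing factor $\ell\colon[0,1]\to[0,1]$: a smooth increasing function that is $0$ near $0$ and has $\ell(1)=1$. The standard simplices $[h_0,\dots,h_p]\colon\Delta^p\to H_A$ are defined inductively by $[h_0]=h_0$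 and $$[h_0,\dots,h_{p+1}](1-t,tx)=h_0\exp_A(\ell(t)X),\qquad \exp_A(X)=[h_0^{-1}h_1,\dots,h_0^{-1}h_{p+1}](x).$$ An even $p$-cochain $\omega\in C^p_0(\mathfrak h)$ is a graded-antisymmetric parity-preserving $p$-linear map $\mathfrak h^p\to\mathbb R$; it induces $\omega_A\colon\mathfrak h_A^p\to A_0$ by $\omega_A(a_1X_1,\dots,a_pX_p)=a_p\cdots a_1\,\omega(X_1,\dots,X_p)$, which is regarded as a left-invariant $A_0$-valued $p$-form on $H_A$. The integrated cochain is $$\Big(\smallint\omega\Big)_A(n_1,\dots,n_p)=\int_{[1,\,n_1,\,n_1n_2,\,\dots,\,n_1\cdots n_p]}\omega_A .$$ **Proposition.** Let $G$ be a Lie supergroup acting on $H$ by automorphisms, i.e. by a smooth map of supermanifolds $G\times H\to H$, $(g,h)\mapsto h^g$, that on $A$-points is an action of the group $G_A$ on $H_A$ by group automorphisms. For $g\in G_A$ let $\mathrm{Ad}(g)\colon\mathfrak h_A\to\mathfrak h_A$ be the derivative of $h\mapsto h^g$ at $1$. 1. The standard simplices are $G$-equivariant: $[h_0^g,\dots,h_q^g](x)=\big([h_0,\dots,h_q](x)\big)^g$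 for all $q$, $A$, $g\in G_A$, $h_0,\dots,h_q\in H_A$ and $x\in\Delta^q$. 2. Let $\omega\in C^p_0(\mathfrak h)$ be invariant under the induced action of $G$ on $\mathfrak h$, i.e. $\omega_A(\mathrm{Ad}(g)X_1,\dots,\mathrm{Ad}(g)X_p)=\omega_A(X_1,\dots,X_p)$ for all $A$, $g\in G_A$, $X_i\in\mathfrak h_A$. Then $\smallint\omega$ is a Lie supergroup $p$-cochain, i.e. a smooth map of supermanifolds $H^p\to\mathbb R$ (where $\mathbb R_A=A_0$), and it is invariant under $G$: for all $A$ and $g\in G_A$, $$\Big(\smallint\omega\Big)_A(n_1^g,\dots,n_p^g)=\Big(\smallint\omega\Big)_A(n_1,\dots,n_p),\qquad \int_{[h_0^g,\dots,h_p^g]}\omega_A=\int_{[h_0,\dots,h_p]}\omega_A$$ for all $n_i,h_i\in H_A$. 3. In particular, let $\mathbb K$ be a finite-dimensional normed division algebra, of dimension $n$ (so $n+2=3,4,6,10$). Let $V$ be the space of hermitian $2\times2$ matrices over $\mathbb K$, with the Minkowski inner product $g$ whose quadratic form is $-\det$, let $S_+=\mathbb K^2$, and let $\mathcal T=V\oplus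 S_+$ be the supertranslation algebra ($V$ even, $S_+$ odd), whose only nonzero bracket is $\psi\cdot\phi=\psi\phi^\dagger+\phi\psi^\dagger-\operatorname{tr}(\psi\phi^\dagger+\phi\psi^\dagger)$ for $\psi,\phi\in S_+$. Let $\alpha$ be the even $3$-cochain on $\mathcal T$ with $\alpha(A,\psi,\phi)=g(A,\psi\cdot\phi)$ for $A\in V$ and $\psi,\phi\in S_+$, which vanishes on the other types of homogeneous arguments. Then $\smallint\alpha$ is a supergroup $3$-cochain on the exponential supergroup $T$ of $\mathcal T$, and it is invariant, in both of the above forms, under the action of the Lorentz group $\mathrm{Spin}(n+1,1)$, regarded as a supergroup with $A$-points $\mathrm{Hom}(C^\infty(\mathrm{Spin}(n+1,1)),A)$. -/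

import Mathlib

open scoped TensorProduct

noncomputable section

namespace Super

/-! ### Norms on finite-dimensional real vector spaces -/

section FiniteDim

variable (E : Type*) [AddCommGroup E] [Module ℝ E] [FiniteDimensional ℝ E]

/-- A norm on a finite-dimensional real vector space, transported from a coordinate space. All
norms on such a space are equivalent, so openness, smoothness, derivatives and integrals do not
depend on the choice. -/
abbrev fdNormedAddCommGroup : NormedAddCommGroup E :=
  NormedAddCommGroup.induced E (Fin (Module.finrank ℝ E) → ℝ)
    (Module.finBasis ℝ E).equivFun (LinearEquiv.injective _)

/-- Compatibility of the norm with the given real vector space structure. -/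
abbrev fdNormedSpace : @NormedSpace ℝ E _ (fdNormedAddCommGroup E).toSeminormedAddCommGroup :=
  letI := fdNormedAddCommGroup E
  NormedSpace.induced ℝ E (Fin (Module.finrank ℝ E) → ℝ) (Module.finBasis ℝ E).equivFun.toLinearMap

end FiniteDim

/-! ### Grassmann algebras -/

/-- The Grassmann algebra `Λ ℝⁿ`. -/
abbrev Gr (n : ℕ) : Type := ExteriorAlgebra ℝ (Fin n → ℝ)

/-- The homogeneous part of the Grassmann algebra of the given parity. -/
abbrev grPart (n : ℕ) (i : ZMod 2) : Submodule ℝ (Gr n) :=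
  CliffordAlgebra.evenOdd (0 : QuadraticForm ℝ (Fin n → ℝ)) i

/-- The even subalgebra `A₀` of the Grassmann algebra `A = Λ ℝⁿ`. -/
abbrev Gr0 (n : ℕ) : Type := ↥(CliffordAlgebra.even (0 : QuadraticForm ℝ (Fin n → ℝ)))

theorem gr0_mem {n : ℕ} (c : Gr0 n) : (c : Gr n) ∈ grPart n 0 := c.2

instance instFiniteGr (n : ℕ) : FiniteDimensional ℝ (Gr n) :=
  Module.Finite.of_basis (Pi.basisFun ℝ (Fin n)).ExteriorAlgebra

instance instFiniteGr0 (n : ℕ) : FiniteDimensional ℝ (Gr0 n) :=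
  inferInstanceAs (FiniteDimensional ℝ
    ↥(Subalgebra.toSubmodule (CliffordAlgebra.even (0 : QuadraticForm ℝ (Fin n → ℝ)))))

instance instNormedAddCommGroupGr0 (n : ℕ) : NormedAddCommGroup (Gr0 n) :=
  fdNormedAddCommGroup (Gr0 n)

instance instNormedSpaceGr0 (n : ℕ) : NormedSpace ℝ (Gr0 n) := fdNormedSpace (Gr0 n)

theorem grPart_mul {n : ℕ} {i j : ZMod 2} {a b : Gr n} (ha : a ∈ grPart n i)
    (hb : b ∈ grPart n j) : a * b ∈ grPart n (i + j) :=
  SetLike.mul_mem_graded ha hb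

/-- The homomorphism `A → ℝ` that kills all nilpotent elements. -/
abbrev grBody (n : ℕ) : Gr n →ₐ[ℝ] ℝ := ExteriorAlgebra.algebraMapInv

theorem grBody_odd {n : ℕ} {a : Gr n} (ha : a ∈ grPart n 1) : grBody n a = 0 := by
  have h : grPart n 1 ≤ LinearMap.ker (grBody n).toLinearMap := by
    refine iSup_le ?_
    rintro ⟨k, hk⟩
    obtain ⟨l, rfl⟩ : ∃ l, k = l + 1 := by
      cases k with
      | zero => simp at hk
      | succ l => exact ⟨l, rfl⟩
    rw [pow_succ]
    refine Submodule.mul_le.2 ?_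
    rintro x - y ⟨v, rfl⟩
    have hv : grBody n (CliffordAlgebra.ι (0 : QuadraticForm ℝ (Fin n → ℝ)) v) = 0 :=
      by simp [ExteriorAlgebra.algebraMapInv]
    simp [hv]
  exact h ha

/-- A homomorphism of Grassmann algebras: an algebra homomorphism that respects the grading. -/
structure GrHom (m n : ℕ) where
  toAlgHom : Gr m →ₐ[ℝ] Gr n
  map_part : ∀ i : ZMod 2, ∀ a ∈ grPart m i, toAlgHom a ∈ grPart n i

/-- The identity homomorphism. -/
def GrHom.id (n : ℕ) : GrHom n n := ⟨AlgHom.id ℝ _, fun _ _ h => h⟩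

/-- Composition of homomorphisms. -/
def GrHom.comp {l m n : ℕ} (g : GrHom m n) (f : GrHom l m) : GrHom l n :=
  ⟨g.toAlgHom.comp f.toAlgHom, fun i a h => g.map_part i _ (f.map_part i a h)⟩

/-- The induced map `f₀ : A₀ → B₀` on even parts. -/
def GrHom.even {m n : ℕ} (f : GrHom m n) (a : Gr0 m) : Gr0 n :=
  ⟨f.toAlgHom a, f.map_part 0 _ a.2⟩

/-! ### Super vector spaces and their points -/

/-- The sign obtained by interchanging homogeneous elements of parities `i` and `j`. -/
def koszul (i j : ZMod 2) : ℝ := if i = 1 ∧ j = 1 then -1 else 1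

/-- A super vector space structure on `V`: a decomposition into an even and an odd part. -/
structure SuperVect (V : Type*) [AddCommGroup V] [Module ℝ V] where
  part : ZMod 2 → Submodule ℝ V
  isCompl : IsCompl (part 0) (part 1)

section Points

variable {V : Type*} [AddCommGroup V] [Module ℝ V] (𝒱 : SuperVect V)

/-- The pure tensors `a ⊗ v` with `a` and `v` of matching parity. -/
def SuperVect.gens (n : ℕ) : Set (Gr n ⊗[ℝ] V) :=
  {z | ∃ (i : ZMod 2) (a : Gr n) (v : V), a ∈ grPart n i ∧ v ∈ 𝒱.part i ∧ z = a ⊗ₜ[ℝ] v}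

/-- `V_A = (A ⊗ V)₀ = A₀ ⊗ V₀ ⊕ A₁ ⊗ V₁`, as an `A₀`-submodule of `A ⊗ V`. -/
def SuperVect.ptsSubmodule (n : ℕ) : Submodule (Gr0 n) (Gr n ⊗[ℝ] V) :=
  { Submodule.span ℝ (𝒱.gens n) with
    smul_mem' := by
      intro c x hx
      change x ∈ Submodule.span ℝ (𝒱.gens n) at hx
      change c • x ∈ Submodule.span ℝ (𝒱.gens n)
      induction hx using Submodule.span_induction with
      | mem x hx =>
        obtain ⟨i, a, v, ha, hv, rfl⟩ := hx
        refine Submodule.subset_span ⟨i, (c : Gr n) * a, v, ?_, hv, ?_⟩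
        · simpa using grPart_mul (gr0_mem c) ha
        · exact TensorProduct.smul_tmul' c a v
      | zero => simp
      | add x y _ _ hx hy => rw [smul_add]; exact Submodule.add_mem _ hx hy
      | smul r x _ hx => rw [smul_comm]; exact Submodule.smul_mem _ r hx }

theorem SuperVect.mem_ptsSubmodule {n : ℕ} {x : Gr n ⊗[ℝ] V} :
    x ∈ 𝒱.ptsSubmodule n ↔ x ∈ Submodule.span ℝ (𝒱.gens n) := Iff.rfl

/-- The `A`-points `V_A` of the supermanifold associated to a super vector space. -/
def SuperVect.Pts (n : ℕ) := ↥(𝒱.ptsSubmodule n)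

instance (n : ℕ) : AddCommGroup (𝒱.Pts n) := inferInstanceAs (AddCommGroup ↥(𝒱.ptsSubmodule n))

instance (n : ℕ) : Module (Gr0 n) (𝒱.Pts n) :=
  inferInstanceAs (Module (Gr0 n) ↥(𝒱.ptsSubmodule n))

instance (n : ℕ) : Module ℝ (𝒱.Pts n) := inferInstanceAs (Module ℝ ↥(𝒱.ptsSubmodule n))

/-- The inclusion of `V_A` into `A ⊗ V`. -/
def SuperVect.incl (n : ℕ) : 𝒱.Pts n →ₗ[ℝ] Gr n ⊗[ℝ] V :=
  ((𝒱.ptsSubmodule n).restrictScalars ℝ).subtype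

theorem SuperVect.incl_mem {n : ℕ} (x : 𝒱.Pts n) :
    𝒱.incl n x ∈ Submodule.span ℝ (𝒱.gens n) := x.2

theorem SuperVect.incl_injective (n : ℕ) : Function.Injective (𝒱.incl n) :=
  Subtype.val_injective

/-- A linear map into `A ⊗ V` with values in `V_A`, as a map into `V_A`. -/
def SuperVect.toPts {n : ℕ} {M : Type*} [AddCommGroup M] [Module ℝ M]
    (f : M →ₗ[ℝ] Gr n ⊗[ℝ] V) (hf : ∀ x, f x ∈ Submodule.span ℝ (𝒱.gens n)) : M →ₗ[ℝ] 𝒱.Pts n :=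
  f.codRestrict ((𝒱.ptsSubmodule n).restrictScalars ℝ) hf

/-- The map `V_f : V_A → V_B` induced by a homomorphism `f : A → B`. -/
def SuperVect.mapPts {m n : ℕ} (f : GrHom m n) : 𝒱.Pts m →ₗ[ℝ] 𝒱.Pts n :=
  𝒱.toPts (LinearMap.rTensor V f.toAlgHom.toLinearMap ∘ₗ 𝒱.incl m) (by
    intro x
    have hx := 𝒱.incl_mem x
    rw [LinearMap.comp_apply]
    generalize 𝒱.incl m x = y at hx ⊢
    induction hx using Submodule.span_induction with
    | mem x hx =>
      obtain ⟨i, a, v, ha, hv, rfl⟩ := hx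
      exact Submodule.subset_span ⟨i, f.toAlgHom a, v, f.map_part i a ha, hv, by simp⟩
    | zero => simp
    | add x y _ _ hx hy => rw [map_add]; exact Submodule.add_mem _ hx hy
    | smul r x _ hx => rw [map_smul]; exact Submodule.smul_mem _ r hx)

/-- The map `L_A = (1 ⊗ L)₀ : V_A → V_A` induced by a parity-preserving linear map `L`. -/
def SuperVect.linPts (n : ℕ) (L : V →ₗ[ℝ] V) (hL : ∀ i, ∀ v ∈ 𝒱.part i, L v ∈ 𝒱.part i) :
    𝒱.Pts n →ₗ[ℝ] 𝒱.Pts n :=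
  𝒱.toPts (LinearMap.lTensor (Gr n) L ∘ₗ 𝒱.incl n) (by
    intro x
    have hx := 𝒱.incl_mem x
    rw [LinearMap.comp_apply]
    generalize 𝒱.incl n x = y at hx ⊢
    induction hx using Submodule.span_induction with
    | mem x hx =>
      obtain ⟨i, a, v, ha, hv, rfl⟩ := hx
      exact Submodule.subset_span ⟨i, a, L v, ha, hL i v hv, by simp⟩
    | zero => simp
    | add x y _ _ hx hy => rw [map_add]; exact Submodule.add_mem _ hx hy
    | smul r x _ hx => rw [map_smul]; exact Submodule.smul_mem _ r hx)

/-- The even part `V₀`, the underlying ordinary vector space of points. -/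
def SuperVect.Base := ↥(𝒱.part 0)

instance : AddCommGroup 𝒱.Base := inferInstanceAs (AddCommGroup ↥(𝒱.part 0))

instance : Module ℝ 𝒱.Base := inferInstanceAs (Module ℝ ↥(𝒱.part 0))

/-- The map `V_A → V_ℝ = V₀` induced by the projection `A → ℝ` that kills nilpotents. -/
def SuperVect.body (n : ℕ) : 𝒱.Pts n →ₗ[ℝ] 𝒱.Base :=
  LinearMap.codRestrict (𝒱.part 0)
    ((TensorProduct.lid ℝ V).toLinearMap ∘ₗ LinearMap.rTensor V (grBody n).toLinearMap ∘ₗ 𝒱.incl n)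
    (by
      intro x
      have hx := 𝒱.incl_mem x
      simp only [LinearMap.comp_apply]
      generalize 𝒱.incl n x = y at hx ⊢
      induction hx using Submodule.span_induction with
      | mem x hx =>
        obtain ⟨i, a, v, ha, hv, rfl⟩ := hx
        simp only [LinearMap.rTensor_tmul, LinearEquiv.coe_coe, TensorProduct.lid_tmul,
          AlgHom.toLinearMap_apply]
        fin_cases i
        · exact Submodule.smul_mem _ _ hv
        · have h0 : grBody n a = 0 := grBody_odd ha
          rw [h0, zero_smul]
          exact Submodule.zero_mem _
      | zero => simp
      | add x y _ _ hx hy => simp only [map_add]; exact Submodule.add_mem _ hx hy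
      | smul r x _ hx => simp only [map_smul]; exact Submodule.smul_mem _ r hx)

variable [FiniteDimensional ℝ V]

instance (n : ℕ) : FiniteDimensional ℝ (𝒱.Pts n) :=
  inferInstanceAs (FiniteDimensional ℝ ↥((𝒱.ptsSubmodule n).restrictScalars ℝ))

instance (n : ℕ) : NormedAddCommGroup (𝒱.Pts n) := fdNormedAddCommGroup (𝒱.Pts n)

instance (n : ℕ) : NormedSpace ℝ (𝒱.Pts n) := fdNormedSpace (𝒱.Pts n)

instance : FiniteDimensional ℝ 𝒱.Base := inferInstanceAs (FiniteDimensional ℝ ↥(𝒱.part 0))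

instance : NormedAddCommGroup 𝒱.Base := fdNormedAddCommGroup 𝒱.Base

instance : NormedSpace ℝ 𝒱.Base := fdNormedSpace 𝒱.Base

/-- The `A`-points of the superdomain over the set `U ⊆ V₀`. -/
def SuperVect.superdomain (U : Set 𝒱.Base) (n : ℕ) : Set (𝒱.Pts n) := 𝒱.body n ⁻¹' U

end Points

/-! ### `A₀`-smooth maps -/

/-- `f` is `A₀`-smooth on the (open) set `S`: it is smooth there and its derivative at each point
of `S` is `A₀`-linear. -/
def A0SmoothOn (n : ℕ) {E F : Type*} [NormedAddCommGroup E] [NormedSpace ℝ E] [Module (Gr0 n) E]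
    [NormedAddCommGroup F] [NormedSpace ℝ F] [Module (Gr0 n) F] (f : E → F) (S : Set E) : Prop :=
  ContDiffOn ℝ ((⊤ : ℕ∞) : WithTop ℕ∞) f S ∧
    ∀ x ∈ S, ∀ (a : Gr0 n) (v : E), fderiv ℝ f x (a • v) = a • fderiv ℝ f x v

/-- The map `f : X → Y` is `A₀`-smooth with respect to the charts `φ : D → X` and `ψ : D' → Y`:
wherever it is defined, the local representative `ψ⁻¹ ∘ f ∘ φ` is `A₀`-smooth. -/
def SmoothInCharts (n : ℕ) {E F X Y : Type*} [NormedAddCommGroup E] [NormedSpace ℝ E]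
    [Module (Gr0 n) E] [NormedAddCommGroup F] [NormedSpace ℝ F] [Module (Gr0 n) F]
    (φ : E → X) (D : Set E) (ψ : F → Y) (D' : Set F) (f : X → Y) : Prop :=
  ∃ τ : E → F, A0SmoothOn n τ {x | x ∈ D ∧ f (φ x) ∈ ψ '' D'} ∧
    ∀ x ∈ D, f (φ x) ∈ ψ '' D' → τ x ∈ D' ∧ ψ (τ x) = f (φ x)

/-! ### Supermanifolds, supergroups -/

/-- A supermanifold modelled on the super vector space `V`: a functor from Grassmann algebras to
Hausdorff spaces with an atlas of superdomains in `V`, whose overlaps are superdomains and whose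
transition functions are smooth maps of superdomains. The atlas makes each space of `A`-points
a smooth manifold. Second countability is not required. -/
structure Supermanifold {V : Type*} [AddCommGroup V] [Module ℝ V] [FiniteDimensional ℝ V]
    (𝒱 : SuperVect V) where
  Pt : ℕ → Type*
  [top : ∀ n, TopologicalSpace (Pt n)]
  [t2 : ∀ n, T2Space (Pt n)]
  map : ∀ {m n : ℕ}, GrHom m n → Pt m → Pt n
  map_id : ∀ (n : ℕ) (x : Pt n), map (GrHom.id n) x = x
  map_comp : ∀ {l m n : ℕ} (g : GrHom m n) (f : GrHom l m) (x : Pt l),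
    map (g.comp f) x = map g (map f x)
  /-- The index set of the atlas. -/
  Index : Type*
  base : Index → Set 𝒱.Base
  base_open : ∀ i, IsOpen (base i)
  /-- The chart on `A`-points; only its values on the superdomain over `base i` matter. -/
  chart : ∀ (_ : Index) (n : ℕ), 𝒱.Pts n → Pt n
  chart_natural : ∀ (i : Index) {m n : ℕ} (f : GrHom m n), ∀ x ∈ 𝒱.superdomain (base i) m,
    map f (chart i m x) = chart i n (𝒱.mapPts f x)
  chart_isOpenEmbedding : ∀ (i : Index) (n : ℕ),
    Topology.IsOpenEmbedding ((𝒱.superdomain (base i) n).domRestrict (chart i n))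
  cover : ∀ (n : ℕ) (y : Pt n), ∃ i, y ∈ chart i n '' 𝒱.superdomain (base i) n
  overlap : ∀ i j : Index, ∃ W : Set 𝒱.Base, IsOpen W ∧
    ∀ n, ∀ x ∈ 𝒱.superdomain (base i) n,
      (chart i n x ∈ chart j n '' 𝒱.superdomain (base j) n ↔ x ∈ 𝒱.superdomain W n)
  transition : ∀ (i j : Index) (n : ℕ),
    SmoothInCharts n (chart i n) (𝒱.superdomain (base i) n)
      (chart j n) (𝒱.superdomain (base j) n) id

attribute [instance] Supermanifold.top Supermanifold.t2

/-- A Lie supergroup: a supermanifold whose spaces of `A`-points are groups, naturally in `A`, such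
that multiplication `G × G → G` and inversion `G → G` are smooth maps of supermanifolds. The charts
of `G × G` are products of charts of `G`. -/
structure LieSupergroup {V : Type*} [AddCommGroup V] [Module ℝ V] [FiniteDimensional ℝ V]
    (𝒱 : SuperVect V) extends Supermanifold 𝒱 where
  [group : ∀ n, Group (Pt n)]
  map_mul : ∀ {m n : ℕ} (f : GrHom m n) (x y : Pt m), map f (x * y) = map f x * map f y
  continuous_mul : ∀ n, Continuous fun z : Pt n × Pt n => z.1 * z.2
  smooth_mul : ∀ (n : ℕ) (i j k : Index),
    SmoothInCharts n (Prod.map (chart i n) (chart j n))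
      (𝒱.superdomain (base i) n ×ˢ 𝒱.superdomain (base j) n)
      (chart k n) (𝒱.superdomain (base k) n) (fun z : Pt n × Pt n => z.1 * z.2)
  continuous_inv : ∀ n, Continuous fun x : Pt n => x⁻¹
  smooth_inv : ∀ (n : ℕ) (i j : Index),
    SmoothInCharts n (chart i n) (𝒱.superdomain (base i) n)
      (chart j n) (𝒱.superdomain (base j) n) (fun x : Pt n => x⁻¹)

attribute [instance] LieSupergroup.group

/-! ### Lie superalgebras -/

/-- A Lie superalgebra structure on `V`. -/
structure LieSuperalgebra (V : Type*) [AddCommGroup V] [Module ℝ V] extends SuperVect V where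
  bracket : V →ₗ[ℝ] V →ₗ[ℝ] V
  bracket_mem : ∀ {i j : ZMod 2} {x y : V}, x ∈ part i → y ∈ part j → bracket x y ∈ part (i + j)
  skew : ∀ {i j : ZMod 2} {x y : V}, x ∈ part i → y ∈ part j →
    bracket x y = -(koszul i j • bracket y x)
  jacobi : ∀ {i j k : ZMod 2} {x y z : V}, x ∈ part i → y ∈ part j → z ∈ part k →
    bracket x (bracket y z) = bracket (bracket x y) z + koszul i j • bracket y (bracket x z)

section Exponential

variable {V : Type*} [AddCommGroup V] [Module ℝ V] (𝔥 : LieSuperalgebra V)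

/-- Nilpotency: for some `k`, any `k` nested brackets vanish. -/
def LieSuperalgebra.IsNilpotent : Prop :=
  ∃ k : ℕ, ∀ (l : List V) (x : V), l.length = k → l.foldr (fun y z => 𝔥.bracket y z) x = 0

/-- The bilinear extension `(a ⊗ X, b ⊗ Y) ↦ b a ⊗ [X, Y]` to `A ⊗ V`. -/
def LieSuperalgebra.bracketAux (n : ℕ) :
    Gr n ⊗[ℝ] V →ₗ[ℝ] Gr n ⊗[ℝ] V →ₗ[ℝ] Gr n ⊗[ℝ] V :=
  TensorProduct.map₂ (LinearMap.mul ℝ (Gr n)).flip 𝔥.bracket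

theorem LieSuperalgebra.bracketAux_tmul (n : ℕ) (a b : Gr n) (x y : V) :
    𝔥.bracketAux n (a ⊗ₜ x) (b ⊗ₜ y) = (b * a) ⊗ₜ 𝔥.bracket x y := by
  simp [LieSuperalgebra.bracketAux]

theorem LieSuperalgebra.bracketAux_mem (n : ℕ) {x y : Gr n ⊗[ℝ] V}
    (hx : x ∈ Submodule.span ℝ (𝔥.gens n)) (hy : y ∈ Submodule.span ℝ (𝔥.gens n)) :
    𝔥.bracketAux n x y ∈ Submodule.span ℝ (𝔥.gens n) := by
  induction hx using Submodule.span_induction with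
  | mem x hx =>
    induction hy using Submodule.span_induction with
    | mem y hy =>
      obtain ⟨i, a, v, ha, hv, rfl⟩ := hx
      obtain ⟨j, b, w, hb, hw, rfl⟩ := hy
      rw [𝔥.bracketAux_tmul]
      exact Submodule.subset_span
        ⟨i + j, b * a, _, add_comm j i ▸ grPart_mul hb ha, 𝔥.bracket_mem hv hw, rfl⟩
    | zero => simp
    | add y z _ _ hy hz => rw [map_add]; exact Submodule.add_mem _ hy hz
    | smul r y _ hy => rw [map_smul]; exact Submodule.smul_mem _ r hy
  | zero => simp
  | add x z _ _ hx hz => rw [map_add, LinearMap.add_apply]; exact Submodule.add_mem _ hx hz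
  | smul r x _ hx => rw [map_smul, LinearMap.smul_apply]; exact Submodule.smul_mem _ r hx

/-- The Lie bracket `[-,-]_A` on the `A`-points of `𝔥`. -/
def LieSuperalgebra.bracketPts (n : ℕ) (x y : 𝔥.Pts n) : 𝔥.Pts n :=
  ⟨𝔥.bracketAux n (𝔥.incl n x) (𝔥.incl n y), 𝔥.bracketAux_mem n (𝔥.incl_mem x) (𝔥.incl_mem y)⟩

/-- The right-nested bracket `[x₁, [x₂, ⋯ [xₖ₋₁, xₖ]]]` of a word. -/
def LieSuperalgebra.nested (n : ℕ) : List (𝔥.Pts n) → 𝔥.Pts n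
  | [] => 0
  | [x] => x
  | x :: y :: l => 𝔥.bracketPts n x (LieSuperalgebra.nested n (y :: l))

/-- The word `X^{r₁} Y^{s₁} ⋯ X^{rₖ} Y^{sₖ}`. -/
def bchWord {α : Type*} (X Y : α) {k : ℕ} (r s : Fin k → ℕ) : List α :=
  (List.ofFn fun i => List.replicate (r i) X ++ List.replicate (s i) Y).flatten

/-- The homogeneous part of degree `d` of the Baker--Campbell--Hausdorff series in `𝔥_A`, in Dynkin's
form: the sum over `k ≥ 1` and over `r, s ∈ ℕᵏ` with all `rᵢ + sᵢ > 0` and `∑ (rᵢ + sᵢ) = d` of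
`(-1)^{k-1} / (k d ∏ rᵢ! sᵢ!) [X^{r₁} Y^{s₁} ⋯ X^{rₖ} Y^{sₖ}]`. -/
def LieSuperalgebra.bchTerm (n d : ℕ) (X Y : 𝔥.Pts n) : 𝔥.Pts n :=
  ∑ k ∈ Finset.Icc 1 d,
    ∑ rs : (Fin k → Fin (d + 1)) × (Fin k → Fin (d + 1)) with
        (∀ i, 0 < (rs.1 i : ℕ) + (rs.2 i : ℕ)) ∧ ∑ i, ((rs.1 i : ℕ) + (rs.2 i : ℕ)) = d,
      ((-1 : ℝ) ^ (k - 1) /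
          ((k : ℝ) * (d : ℝ) * ∏ i, (((rs.1 i : ℕ).factorial : ℝ) * ((rs.2 i : ℕ).factorial : ℝ)))) •
        𝔥.nested n (bchWord X Y (fun i => (rs.1 i : ℕ)) (fun i => (rs.2 i : ℕ)))

/-- Multiplication in the exponential supergroup `H` of `𝔥` on `A`-points, where `H_A` is identified
with `𝔥_A` through the exponential map: the Baker--Campbell--Hausdorff series (which has only finitely
many nonzero terms if `𝔥` is nilpotent). -/
def LieSuperalgebra.expMul (n : ℕ) (X Y : 𝔥.Pts n) : 𝔥.Pts n := ∑ᶠ d : ℕ, 𝔥.bchTerm n d X Y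

/-- Inversion in the exponential supergroup. -/
def LieSuperalgebra.expInv (n : ℕ) (X : 𝔥.Pts n) : 𝔥.Pts n := -X

/-- The identity of the exponential supergroup. -/
def LieSuperalgebra.expOne (n : ℕ) : 𝔥.Pts n := 0

/-! ### Standard simplices -/

/-- A smoothing factor: a smooth increasing function `[0,1] → [0,1]` that vanishes on a neighbourhood
of `0` and increases to `1` at `1`. Only its values on `[0,1]` matter. -/
def IsSmoothingFactor (ℓ : ℝ → ℝ) : Prop :=
  ContDiffOn ℝ ((⊤ : ℕ∞) : WithTop ℕ∞) ℓ (Set.Icc 0 1) ∧ MonotoneOn ℓ (Set.Icc 0 1) ∧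
    (∃ ε > 0, ∀ t ∈ Set.Icc (0 : ℝ) 1, t < ε → ℓ t = 0) ∧ ℓ 1 = 1

/-- The standard simplex `[h₀, …, h_p] : Δᵖ → H_A` with smoothing factor `ℓ`, as a function of
barycentric coordinates: `[h₀] = h₀`, and `[h₀, …, h_{p+1}]` is obtained from the base
`[h₀⁻¹ h₁, …, h₀⁻¹ h_{p+1}]` by sending the point with barycentric coordinates `(1 - t, t x)` to
`h₀ exp (ℓ(t) X)`, where `exp X` is the point of the base with coordinates `x`. -/
def LieSuperalgebra.simplex (n : ℕ) (ℓ : ℝ → ℝ) :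
    ∀ p : ℕ, (Fin (p + 1) → 𝔥.Pts n) → (Fin (p + 1) → ℝ) → 𝔥.Pts n
  | 0, h, _ => h 0
  | p + 1, h, x => 𝔥.expMul n (h 0)
      (ℓ (1 - x 0) • LieSuperalgebra.simplex n ℓ p
        (fun i => 𝔥.expMul n (𝔥.expInv n (h 0)) (h i.succ)) (fun i => x i.succ / (1 - x 0)))

/-! ### Even cochains -/

/-- An even Lie superalgebra `p`-cochain on `𝔥`: a graded-antisymmetric, parity-preserving,
`p`-linear map to `ℝ`. -/
structure EvenCochain (p : ℕ) where
  toMap : MultilinearMap ℝ (fun _ : Fin p => V) ℝ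
  antisymm : ∀ (d : Fin p → ZMod 2) (x : Fin p → V), (∀ k, x k ∈ 𝔥.part (d k)) →
    ∀ i j : Fin p, (i : ℕ) + 1 = j →
      toMap (x ∘ Equiv.swap i j) = -(koszul (d i) (d j) * toMap x)
  even : ∀ (d : Fin p → ZMod 2) (x : Fin p → V), (∀ k, x k ∈ 𝔥.part (d k)) →
    ∑ k, d k ≠ 0 → toMap x = 0

variable {𝔥} [FiniteDimensional ℝ V] {p : ℕ}

/-- The multilinear extension `(a₁ ⊗ v₁, …, a_p ⊗ v_p) ↦ a_p ⋯ a₁ ω(v₁, …, v_p)` to `A ⊗ V`, written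
in a basis of `V`. -/
def EvenCochain.ext (ω : EvenCochain 𝔥 p) (n : ℕ) :
    MultilinearMap ℝ (fun _ : Fin p => Gr n ⊗[ℝ] V) (Gr n) :=
  ∑ c : Fin p → Fin (Module.finrank ℝ V),
    ω.toMap (fun k => Module.finBasis ℝ V (c k)) •
      ((MultilinearMap.mkPiAlgebraFin ℝ p (Gr n)).domDomCongr Fin.revPerm).compLinearMap
        (fun k => (TensorProduct.rid ℝ (Gr n)).toLinearMap ∘ₗ
          LinearMap.lTensor (Gr n) ((Module.finBasis ℝ V).coord (c k)))

theorem EvenCochain.ext_tmul (ω : EvenCochain 𝔥 p) (n : ℕ) (a : Fin p → Gr n) (v : Fin p → V) :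
    ω.ext n (fun k => a k ⊗ₜ v k) = ω.toMap v • (List.ofFn fun k => a k.rev).prod := by
  have hv : v = fun k => ∑ j, (Module.finBasis ℝ V).repr (v k) j • Module.finBasis ℝ V j := by
    funext k; exact ((Module.finBasis ℝ V).sum_repr (v k)).symm
  have key : ω.toMap v = ∑ c : Fin p → Fin (Module.finrank ℝ V),
      (∏ k, (Module.finBasis ℝ V).repr (v k) (c k)) *
        ω.toMap (fun k => Module.finBasis ℝ V (c k)) := by
    conv_lhs => rw [hv]
    rw [MultilinearMap.map_sum]
    refine Finset.sum_congr rfl fun c _ => ?_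
    rw [MultilinearMap.map_smul_univ, smul_eq_mul]
  rw [key, Finset.sum_smul]
  simp only [EvenCochain.ext, sum_apply, smul_apply]
  refine Finset.sum_congr rfl fun c _ => ?_
  rw [mul_comm, mul_smul]
  congr 1
  have : (fun k => ((TensorProduct.rid ℝ (Gr n)).toLinearMap ∘ₗ
          LinearMap.lTensor (Gr n) ((Module.finBasis ℝ V).coord (c k))) (a k ⊗ₜ[ℝ] v k))
        = fun k => (Module.finBasis ℝ V).repr (v k) (c k) • a k := by
    funext k; simp
  rw [MultilinearMap.compLinearMap_apply, this, MultilinearMap.map_smul_univ]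
  simp [MultilinearMap.domDomCongr_apply]

theorem grPart_ofFn_prod {n p : ℕ} (d : Fin p → ZMod 2) (a : Fin p → Gr n)
    (h : ∀ k, a k ∈ grPart n (d k)) : (List.ofFn a).prod ∈ grPart n (∑ k, d k) := by
  have := SetLike.list_prod_ofFn_mem_graded (A := grPart n) d a h
  rwa [List.sum_ofFn] at this

theorem EvenCochain.ext_mem (ω : EvenCochain 𝔥 p) (n : ℕ) (x : Fin p → Gr n ⊗[ℝ] V)
    (hx : ∀ k, x k ∈ Submodule.span ℝ (𝔥.gens n)) : ω.ext n x ∈ grPart n 0 := by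
  classical
  suffices H : ∀ (s : Finset (Fin p)) (x : Fin p → Gr n ⊗[ℝ] V),
      (∀ k ∈ s, x k ∈ Submodule.span ℝ (𝔥.gens n)) → (∀ k ∉ s, x k ∈ 𝔥.gens n) →
      ω.ext n x ∈ grPart n 0 from H Finset.univ x (fun k _ => hx k) (by simp)
  intro s
  induction s using Finset.induction_on with
  | empty =>
    intro x _ hx
    choose d a v ha hv h using fun k => hx k (Finset.notMem_empty k)
    obtain rfl : x = fun k => a k ⊗ₜ[ℝ] v k := funext h
    rw [ω.ext_tmul]
    by_cases hd : ∑ k, d k = 0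
    · refine Submodule.smul_mem _ _ ?_
      have := grPart_ofFn_prod (fun k => d k.rev) (fun k => a k.rev) (fun k => ha k.rev)
      have e : ∑ k : Fin p, d k.rev = ∑ k, d k := Equiv.sum_comp Fin.revPerm d
      rwa [e, hd] at this
    · rw [ω.even d v hv hd, zero_smul]; exact Submodule.zero_mem _
  | insert i s hi ih =>
    intro x h1 h2
    have key : ∀ y ∈ Submodule.span ℝ (𝔥.gens n),
        ω.ext n (Function.update x i y) ∈ grPart n 0 := by
      intro y hy
      induction hy using Submodule.span_induction with
      | mem y hy =>
        refine ih _ (fun k hk => ?_) (fun k hk => ?_)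
        · have : k ≠ i := fun h => hi (h ▸ hk)
          rw [Function.update_of_ne this]
          exact h1 k (Finset.mem_insert_of_mem hk)
        · by_cases hki : k = i
          · subst hki; simpa using hy
          · rw [Function.update_of_ne hki]
            exact h2 k (by simp [hki, hk])
      | zero => rw [MultilinearMap.map_update_zero]; exact Submodule.zero_mem _
      | add y z _ _ hy hz => rw [MultilinearMap.map_update_add]; exact Submodule.add_mem _ hy hz
      | smul r y _ hy => rw [MultilinearMap.map_update_smul]; exact Submodule.smul_mem _ r hy
    simpa using key (x i) (h1 i (Finset.mem_insert_self i s))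

/-- The `A₀`-valued cochain `ω_A` on `𝔥_A` induced by an even cochain `ω`. -/
def EvenCochain.onPts (ω : EvenCochain 𝔥 p) (n : ℕ) (x : Fin p → 𝔥.Pts n) : Gr0 n :=
  ⟨ω.ext n (fun k => 𝔥.incl n (x k)), ω.ext_mem n _ fun k => 𝔥.incl_mem (x k)⟩

/-! ### Integration of cochains -/

/-- The left-invariant `A₀`-valued `p`-form on `H_A` determined by `ω_A`, at the point `h`: tangent
vectors at `h` are moved to the identity by the derivative of left translation by `h⁻¹`. -/
def EvenCochain.form (ω : EvenCochain 𝔥 p) (n : ℕ) (h : 𝔥.Pts n) (v : Fin p → 𝔥.Pts n) : Gr0 n :=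
  ω.onPts n fun i => fderiv ℝ (fun k => 𝔥.expMul n (𝔥.expInv n h) k) h (v i)

/-- The region `{t ∈ ℝᵖ | tᵢ ≥ 0, ∑ tᵢ ≤ 1}`, which parametrizes the standard simplex `Δᵖ` through its
last `p` barycentric coordinates. -/
def corner (p : ℕ) : Set (Fin p → ℝ) := {t | (∀ i, 0 ≤ t i) ∧ ∑ i, t i ≤ 1}

/-- The barycentric coordinates `(1 - ∑ tᵢ, t₁, …, t_p)`. -/
def bary {p : ℕ} (t : Fin p → ℝ) : Fin (p + 1) → ℝ := Fin.cons (1 - ∑ i, t i) t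

/-- The integral `∫_S ω_A` of the left-invariant form determined by `ω_A` over `S : Δᵖ → H_A`. -/
def EvenCochain.integral (ω : EvenCochain 𝔥 p) (n : ℕ) (S : (Fin (p + 1) → ℝ) → 𝔥.Pts n) : Gr0 n :=
  ∫ t in corner p, ω.form n (S (bary t))
    fun i => fderivWithin ℝ (fun s => S (bary s)) (corner p) t (Pi.single i 1)

/-- The vertices `1, n₁, n₁ n₂, …, n₁ n₂ ⋯ n_p`. -/
def LieSuperalgebra.vertices (𝔥 : LieSuperalgebra V) (n : ℕ) (h : Fin p → 𝔥.Pts n) :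
    Fin (p + 1) → 𝔥.Pts n :=
  fun k => Fin.induction (motive := fun _ => 𝔥.Pts n) (𝔥.expOne n)
    (fun i g => 𝔥.expMul n g (h i)) k

/-- The integrated cochain in homogeneous form: `(h₀, …, h_p) ↦ ∫_{[h₀, …, h_p]} ω_A`. -/
def EvenCochain.intHom (ω : EvenCochain 𝔥 p) (ℓ : ℝ → ℝ) (n : ℕ) (h : Fin (p + 1) → 𝔥.Pts n) :
    Gr0 n :=
  ω.integral n (𝔥.simplex n ℓ p h)

/-- The integrated supergroup cochain
`(∫ω)_A (n₁, …, n_p) = ∫_{[1, n₁, n₁ n₂, …, n₁ n₂ ⋯ n_p]} ω_A`. -/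
def EvenCochain.int (ω : EvenCochain 𝔥 p) (ℓ : ℝ → ℝ) (n : ℕ) (h : Fin p → 𝔥.Pts n) : Gr0 n :=
  ω.intHom ℓ n (𝔥.vertices n h)

/-- A real-valued supergroup `p`-cochain on the exponential supergroup of `𝔥`: a smooth map of
supermanifolds `Hᵖ → ℝ`, where the `A`-points of `ℝ` are `A₀`. -/
def IsSupergroupCochain (𝔥 : LieSuperalgebra V) (p : ℕ) (F : ∀ n, (Fin p → 𝔥.Pts n) → Gr0 n) : Prop :=
  (∀ {m n : ℕ} (f : GrHom m n) (h : Fin p → 𝔥.Pts m),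
      F n (fun i => 𝔥.mapPts f (h i)) = f.even (F m h)) ∧
    ∀ n, A0SmoothOn n (F n) Set.univ

/-! ### Actions of supergroups -/

/-- An action by automorphisms of a Lie supergroup `G` on the exponential supergroup `H` of `𝔥`: a
smooth map of supermanifolds `G × H → H` that induces, on `A`-points, an action of the group `G_A` on
`H_A` by group automorphisms. The supermanifold `H` has the single global chart `𝔥`. -/
structure SupergroupAction {W : Type*} [AddCommGroup W] [Module ℝ W] [FiniteDimensional ℝ W]
    {𝒲 : SuperVect W} (G : LieSupergroup 𝒲) (𝔥 : LieSuperalgebra V) where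
  act : ∀ n : ℕ, G.Pt n → 𝔥.Pts n → 𝔥.Pts n
  natural : ∀ {m n : ℕ} (f : GrHom m n) (g : G.Pt m) (h : 𝔥.Pts m),
    𝔥.mapPts f (act m g h) = act n (G.map f g) (𝔥.mapPts f h)
  smooth : ∀ (n : ℕ) (i : G.Index),
    A0SmoothOn n (fun z : 𝒲.Pts n × 𝔥.Pts n => act n (G.chart i n z.1) z.2)
      (𝒲.superdomain (G.base i) n ×ˢ Set.univ)
  one_act : ∀ (n : ℕ) (h : 𝔥.Pts n), act n 1 h = h
  mul_act : ∀ (n : ℕ) (g g' : G.Pt n) (h : 𝔥.Pts n), act n (g * g') h = act n g (act n g' h)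
  act_mul : ∀ (n : ℕ) (g : G.Pt n) (h h' : 𝔥.Pts n),
    act n g (𝔥.expMul n h h') = 𝔥.expMul n (act n g h) (act n g h')

variable {W : Type*} [AddCommGroup W] [Module ℝ W] [FiniteDimensional ℝ W] {𝒲 : SuperVect W}
  {G : LieSupergroup 𝒲}

/-- The induced action of `g ∈ G_A` on `𝔥_A`: the derivative at the identity of the action on `H_A`. -/
def SupergroupAction.Ad (α : SupergroupAction G 𝔥) (n : ℕ) (g : G.Pt n) : 𝔥.Pts n →L[ℝ] 𝔥.Pts n :=
  fderiv ℝ (α.act n g) (𝔥.expOne n)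

/-- The even cochain `ω` is invariant under the induced action of `G` on `𝔥`. -/
def EvenCochain.IsInvariant (ω : EvenCochain 𝔥 p) (α : SupergroupAction G 𝔥) : Prop :=
  ∀ (n : ℕ) (g : G.Pt n) (x : Fin p → 𝔥.Pts n),
    ω.onPts n (fun i => α.Ad n g (x i)) = ω.onPts n x

end Exponential

/-! ### Supertranslations -/

/-- A finite-dimensional normed division algebra: a unital, not necessarily associative, real algebra
with an inner product norm satisfying `‖a b‖ = ‖a‖ ‖b‖`. By Hurwitz's theorem these are the real
numbers, the complex numbers, the quaternions and the octonions. -/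
structure NormedDivisionAlgebra (K : Type*) [NormedAddCommGroup K] [InnerProductSpace ℝ K] where
  mul : K →ₗ[ℝ] K →ₗ[ℝ] K
  one : K
  one_ne_zero : one ≠ 0
  one_mul : ∀ a, mul one a = a
  mul_one : ∀ a, mul a one = a
  norm_mul : ∀ a b, ‖mul a b‖ = ‖a‖ * ‖b‖

/-- Vectors: `(t, x, y)` stands for the hermitian matrix `[[t + x, y*], [y, t - x]]` over `K`. -/
abbrev Vec (K : Type*) : Type _ := ℝ × ℝ × K

/-- Spinors: column vectors in `K²`. -/
abbrev Spinor (K : Type*) : Type _ := K × K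

/-- The underlying vector space `V ⊕ S₊` of the supertranslation algebra. -/
abbrev STrans (K : Type*) : Type _ := Vec K × Spinor K

namespace NormedDivisionAlgebra

variable {K : Type*} [NormedAddCommGroup K] [InnerProductSpace ℝ K] (D : NormedDivisionAlgebra K)

/-- Conjugation `a* = 2 ⟨1, a⟩ 1 - a`. -/
def conj : K →ₗ[ℝ] K :=
  (2 : ℝ) • (innerSL ℝ D.one).toLinearMap.smulRight D.one - LinearMap.id

theorem conj_apply (a : K) : D.conj a = (2 * inner ℝ D.one a) • D.one - a := by
  simp [conj, mul_smul]

/-- The Minkowski inner product on `V`, of signature `(n+1, 1)`: its quadratic form is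
`-det = -t² + x² + |y|²`. -/
def minkowski : Vec K →ₗ[ℝ] Vec K →ₗ[ℝ] ℝ :=
  LinearMap.mk₂ ℝ (fun A B => -(A.1 * B.1) + A.2.1 * B.2.1 + inner ℝ A.2.2 B.2.2)
    (by intros; simp only [Prod.fst_add, Prod.snd_add, inner_add_left]; ring)
    (by intros; simp only [Prod.smul_fst, Prod.smul_snd, inner_smul_left, smul_eq_mul,
          RCLike.conj_to_real]; ring)
    (by intros; simp only [Prod.fst_add, Prod.snd_add, inner_add_right]; ring)
    (by intros; simp only [Prod.smul_fst, Prod.smul_snd, inner_smul_right, smul_eq_mul]; ring)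

/-- The bracket of spinors `ψ · φ = ψ φ† + φ ψ† - tr (ψ φ† + φ ψ†)` on `S₊`. -/
def dot : Spinor K →ₗ[ℝ] Spinor K →ₗ[ℝ] Vec K :=
  LinearMap.mk₂ ℝ (fun ψ φ =>
      (-(inner ℝ ψ.1 φ.1 + inner ℝ ψ.2 φ.2), inner ℝ ψ.1 φ.1 - inner ℝ ψ.2 φ.2,
        D.mul ψ.2 (D.conj φ.1) + D.mul φ.2 (D.conj ψ.1)))
    (by
      intros
      ext
      · simp only [Prod.fst_add, Prod.snd_add, inner_add_left]; ring
      · simp only [Prod.fst_add, Prod.snd_add, inner_add_left]; ring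
      · simp only [Prod.fst_add, Prod.snd_add, map_add, LinearMap.add_apply]; abel)
    (by
      intros
      ext
      · simp only [Prod.smul_fst, Prod.smul_snd, inner_smul_left, smul_eq_mul,
          RCLike.conj_to_real]; ring
      · simp only [Prod.smul_fst, Prod.smul_snd, inner_smul_left, smul_eq_mul,
          RCLike.conj_to_real]; ring
      · simp only [Prod.smul_fst, Prod.smul_snd, map_smul, LinearMap.smul_apply, smul_add])
    (by
      intros
      ext
      · simp only [Prod.fst_add, Prod.snd_add, inner_add_right]; ring
      · simp only [Prod.fst_add, Prod.snd_add, inner_add_right]; ring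
      · simp only [Prod.fst_add, Prod.snd_add, map_add, LinearMap.add_apply]; abel)
    (by
      intros
      ext
      · simp only [Prod.smul_fst, Prod.smul_snd, inner_smul_right, smul_eq_mul]; ring
      · simp only [Prod.smul_fst, Prod.smul_snd, inner_smul_right, smul_eq_mul]; ring
      · simp only [Prod.smul_fst, Prod.smul_snd, map_smul, LinearMap.smul_apply, smul_add])

theorem dot_comm (ψ φ : Spinor K) : D.dot ψ φ = D.dot φ ψ := by
  ext
  · simp [dot, real_inner_comm]
  · simp [dot, real_inner_comm]
  · simp only [dot, LinearMap.mk₂_apply]; abel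

/-- The even part of the supertranslation algebra is `V`, the odd part is `S₊`. -/
def tPart (i : ZMod 2) : Submodule ℝ (STrans K) :=
  if i = 0 then Submodule.prod ⊤ ⊥ else Submodule.prod ⊥ ⊤

theorem mem_tPart_zero {x : STrans K} : x ∈ tPart (K := K) 0 ↔ x.2 = 0 := by
  simp [tPart, Submodule.mem_prod]

theorem mem_tPart_one {x : STrans K} : x ∈ tPart (K := K) 1 ↔ x.1 = 0 := by
  simp [tPart, Submodule.mem_prod]

/-- The bracket of the supertranslation algebra: `[(A, ψ), (B, φ)] = (ψ · φ, 0)`. -/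
def tBracket : STrans K →ₗ[ℝ] STrans K →ₗ[ℝ] STrans K :=
  (D.dot.compl₁₂ (LinearMap.snd ℝ (Vec K) (Spinor K)) (LinearMap.snd ℝ (Vec K) (Spinor K))).compr₂
    (LinearMap.inl ℝ (Vec K) (Spinor K))

theorem tBracket_apply (x y : STrans K) : D.tBracket x y = (D.dot x.2 y.2, 0) := rfl

/-- The supertranslation algebra `𝒯 = V ⊕ S₊`. -/
def supertranslation : LieSuperalgebra (STrans K) where
  part := tPart
  isCompl := by
    constructor
    · rw [Submodule.disjoint_def]
      intro x h0 h1
      exact Prod.ext (mem_tPart_one.1 h1) (mem_tPart_zero.1 h0)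
    · rw [codisjoint_iff_le_sup]
      intro x _
      refine Submodule.mem_sup.2 ⟨(x.1, 0), mem_tPart_zero.2 rfl, (0, x.2), mem_tPart_one.2 rfl, ?_⟩
      simp
  bracket := D.tBracket
  bracket_mem := by
    intro i j x y hx hy
    rw [tBracket_apply]
    fin_cases i <;> fin_cases j
    · exact mem_tPart_zero.2 rfl
    · have hx' := mem_tPart_zero.1 hx
      rw [hx', map_zero, LinearMap.zero_apply]
      exact Submodule.zero_mem _
    · have hy' := mem_tPart_zero.1 hy
      rw [hy', map_zero]
      exact Submodule.zero_mem _
    · exact mem_tPart_zero.2 rfl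
  skew := by
    intro i j x y hx hy
    rw [tBracket_apply, tBracket_apply]
    fin_cases i <;> fin_cases j
    · have hx' := mem_tPart_zero.1 hx
      rw [hx']; simp
    · have hx' := mem_tPart_zero.1 hx
      rw [hx']; simp
    · have hy' := mem_tPart_zero.1 hy
      rw [hy']; simp
    · rw [D.dot_comm y.2 x.2]
      have hk : koszul ((fun i => i) ⟨1, by decide⟩) ((fun i => i) ⟨1, by decide⟩) = -1 :=
        if_pos ⟨rfl, rfl⟩
      rw [hk, neg_one_smul, neg_neg]
  jacobi := by
    intro i j k x y z _ _ _
    simp [tBracket_apply]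

/-- The trilinear map `(X₁, X₂, X₃) ↦ g(A₁, ψ₂ · ψ₃) - g(A₂, ψ₁ · ψ₃) + g(A₃, ψ₁ · ψ₂)`, where
`Xᵢ = (Aᵢ, ψᵢ)`: the unique graded-antisymmetric trilinear map whose value on a vector `A` and spinors
`ψ, φ` is `g(A, ψ · φ)` and which vanishes on three vectors, on two vectors and a spinor, and on three
spinors. -/
def alphaMap : MultilinearMap ℝ (fun _ : Fin 3 => STrans K) ℝ :=
  MultilinearMap.mk' (fun X =>
      minkowski (X 0).1 (D.dot (X 1).2 (X 2).2) - minkowski (X 1).1 (D.dot (X 0).2 (X 2).2)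
        + minkowski (X 2).1 (D.dot (X 0).2 (X 1).2))
    (by
      intro m i x y
      fin_cases i <;> simp <;> ring)
    (by
      intro m i c x
      fin_cases i <;> simp <;> ring)

theorem alphaMap_apply (X : Fin 3 → STrans K) : D.alphaMap X =
    minkowski (X 0).1 (D.dot (X 1).2 (X 2).2) - minkowski (X 1).1 (D.dot (X 0).2 (X 2).2)
        + minkowski (X 2).1 (D.dot (X 0).2 (X 1).2) := rfl

/-- The even `3`-cochain `α` on the supertranslation algebra, `α(A, ψ, φ) = g(A, ψ · φ)`. -/
def alpha : EvenCochain D.supertranslation 3 where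
  toMap := D.alphaMap
  antisymm := by
    intro d x hx i j hij
    have two : ∀ e : ZMod 2, e = 0 ∨ e = 1 := by decide
    have h0 : ∀ k, d k = 0 → (x k).2 = 0 := fun k h => mem_tPart_zero.1 (h ▸ hx k)
    have h1 : ∀ k, d k = 1 → (x k).1 = 0 := fun k h => mem_tPart_one.1 (h ▸ hx k)
    have c1 := D.dot_comm (x 0).2 (x 1).2
    have c2 := D.dot_comm (x 0).2 (x 2).2
    have c3 := D.dot_comm (x 1).2 (x 2).2
    have s01 : (Equiv.swap (0 : Fin 3) 1) 2 = 2 := by decide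
    have s12 : (Equiv.swap (1 : Fin 3) 2) 0 = 0 := by decide
    have hc : (i = 0 ∧ j = 1) ∨ (i = 1 ∧ j = 2) := by
      rcases i with ⟨i, hi⟩
      rcases j with ⟨j, hj⟩
      simp only [Fin.ext_iff] at hij ⊢
      simp
      omega
    rcases hc with ⟨rfl, rfl⟩ | ⟨rfl, rfl⟩
    · rw [alphaMap_apply, alphaMap_apply]
      simp only [Function.comp_apply, Equiv.swap_apply_left, Equiv.swap_apply_right, s01]
      rcases two (d 0) with e0 | e0 <;> rcases two (d 1) with e1 | e1 <;>
        first
        | (rw [h0 0 e0, h0 1 e1, e0, e1]; simp [koszul])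
        | (rw [h0 0 e0, h1 1 e1, e0, e1]; simp [koszul])
        | (rw [h1 0 e0, h0 1 e1, e0, e1]; simp [koszul])
        | (rw [h1 0 e0, h1 1 e1, e0, e1, c1]; simp [koszul])
    · rw [alphaMap_apply, alphaMap_apply]
      simp only [Function.comp_apply, Equiv.swap_apply_left, Equiv.swap_apply_right, s12]
      rcases two (d 1) with e0 | e0 <;> rcases two (d 2) with e1 | e1 <;>
        first
        | (rw [h0 1 e0, h0 2 e1, e0, e1]; simp [koszul])
        | (rw [h0 1 e0, h1 2 e1, e0, e1]; simp [koszul])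
        | (rw [h1 1 e0, h0 2 e1, e0, e1]; simp [koszul])
        | (rw [h1 1 e0, h1 2 e1, e0, e1, c3]; simp [koszul])
  even := by
    intro d x hx hd
    have two : ∀ e : ZMod 2, e = 0 ∨ e = 1 := by decide
    have h0 : ∀ k, d k = 0 → (x k).2 = 0 := fun k h => mem_tPart_zero.1 (h ▸ hx k)
    have h1 : ∀ k, d k = 1 → (x k).1 = 0 := fun k h => mem_tPart_one.1 (h ▸ hx k)
    rw [Fin.sum_univ_three] at hd
    rw [alphaMap_apply]
    rcases two (d 0) with e0 | e0 <;> rcases two (d 1) with e1 | e1 <;>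
      rcases two (d 2) with e2 | e2 <;> rw [e0, e1, e2] at hd
    · exact absurd (by decide) hd
    · rw [h0 0 e0, h0 1 e1]; simp
    · rw [h0 0 e0, h0 2 e2]; simp
    · exact absurd (by decide) hd
    · rw [h0 1 e1, h0 2 e2]; simp
    · exact absurd (by decide) hd
    · exact absurd (by decide) hd
    · rw [h1 0 e0, h1 1 e1, h1 2 e2]; simp

theorem prodMap_mem (f : Vec K →ₗ[ℝ] Vec K) (g : Spinor K →ₗ[ℝ] Spinor K) (i : ZMod 2)
    (v : STrans K) (hv : v ∈ D.supertranslation.part i) :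
    f.prodMap g v ∈ D.supertranslation.part i := by
  fin_cases i
  · have h := mem_tPart_zero.1 hv
    exact mem_tPart_zero.2 (by simp [h])
  · have h := mem_tPart_one.1 hv
    exact mem_tPart_one.2 (by simp [h])

/-! The group `Spin(n+1, 1)`. The Clifford algebra of `V`, with `v² = g(v, v)`, acts on `S₊ ⊕ S₋`:
a vector `A` sends `ψ ∈ S₊` to `A ψ ∈ S₋` and `φ ∈ S₋` to `Ã φ ∈ S₊`, where `Ã = A - tr A`. -/

/-- The matrix product `A ψ`. -/
def gammaPlus (A : Vec K) : Spinor K →ₗ[ℝ] Spinor K :=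
  LinearMap.prod
    ((A.1 + A.2.1) • LinearMap.fst ℝ K K + D.mul (D.conj A.2.2) ∘ₗ LinearMap.snd ℝ K K)
    (D.mul A.2.2 ∘ₗ LinearMap.fst ℝ K K + (A.1 - A.2.1) • LinearMap.snd ℝ K K)

/-- The matrix product `Ã φ`, where `Ã = A - tr A`. -/
def gammaMinus (A : Vec K) : Spinor K →ₗ[ℝ] Spinor K := D.gammaPlus (-A.1, A.2)

/-- Conjugation `v ↦ B v B⁻¹ = 2 (g(B, v) / g(B, B)) B - v` in the Clifford algebra. -/
def conjVec (B : Vec K) : Vec K →ₗ[ℝ] Vec K :=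
  (2 / minkowski B B) • (minkowski B).smulRight B - LinearMap.id

variable [FiniteDimensional ℝ K]

/-- The action of the product `A B ∈ Spin(n+1, 1)` of two vectors on `V` and on `S₊`. -/
def spinGen (A B : Vec K) : (Vec K →L[ℝ] Vec K) × (Spinor K →L[ℝ] Spinor K) :=
  (LinearMap.toContinuousLinearMap (conjVec A ∘ₗ conjVec B),
    LinearMap.toContinuousLinearMap (D.gammaMinus A ∘ₗ D.gammaPlus B))

/-- The Lorentz group `Spin(n+1, 1)`, the double cover of `SO₀(n+1, 1)`, as the group of pairs
consisting of the actions of its elements on `V` and on `S₊` (a faithful representation). It is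
generated by the products of two unit vectors that are both spacelike or both timelike; as `A B` has
inverse `B A`, the generated submonoid is a group. -/
def spin : Submonoid ((Vec K →L[ℝ] Vec K) × (Spinor K →L[ℝ] Spinor K)) :=
  Submonoid.closure {u | ∃ A B : Vec K, minkowski A A = minkowski B B ∧ |minkowski A A| = 1 ∧
    u = D.spinGen A B}

end NormedDivisionAlgebra

/-- The algebra of smooth real functions on a closed submanifold `S` of a normed space: the
restrictions to `S` of smooth functions on the ambient space. -/
def smoothFunctions {E : Type*} [NormedAddCommGroup E] [NormedSpace ℝ E] (S : Set E) :
    Subalgebra ℝ (S → ℝ) where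
  carrier := {f | ∃ F : E → ℝ, ContDiff ℝ ((⊤ : ℕ∞) : WithTop ℕ∞) F ∧ ∀ s : S, f s = F s}
  mul_mem' := by
    rintro f g ⟨F, hF, h⟩ ⟨F', hF', h'⟩
    exact ⟨fun x => F x * F' x, hF.mul hF', fun s => by simp [h, h']⟩
  add_mem' := by
    rintro f g ⟨F, hF, h⟩ ⟨F', hF', h'⟩
    exact ⟨fun x => F x + F' x, hF.add hF', fun s => by simp [h, h']⟩
  algebraMap_mem' := fun r => ⟨fun _ => r, contDiff_const, fun _ => rfl⟩

namespace NormedDivisionAlgebra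

variable {K : Type*} [NormedAddCommGroup K] [InnerProductSpace ℝ K] [FiniteDimensional ℝ K]
  (D : NormedDivisionAlgebra K)

/-- The `A`-points of the Lie group `Spin(n+1, 1)` regarded as a supergroup: the homomorphisms of
superalgebras from its algebra of smooth functions to `A`. As smooth functions are even, these take
values in `A₀`. -/
abbrev SpinPts (n : ℕ) : Type _ :=
  smoothFunctions (D.spin : Set ((Vec K →L[ℝ] Vec K) × (Spinor K →L[ℝ] Spinor K))) →ₐ[ℝ] Gr0 n

/-- The matrix coefficients of the action of `Spin(n+1, 1)` on `V`, in a basis of `V`. -/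
def coeffVec (i j : Fin (Module.finrank ℝ (Vec K))) :
    smoothFunctions (D.spin : Set ((Vec K →L[ℝ] Vec K) × (Spinor K →L[ℝ] Spinor K))) :=
  ⟨fun u => (Module.finBasis ℝ (Vec K)).coord i (u.1.1 (Module.finBasis ℝ (Vec K) j)),
    fun u => LinearMap.toContinuousLinearMap ((Module.finBasis ℝ (Vec K)).coord i)
      (u.1 (Module.finBasis ℝ (Vec K) j)),
    (ContinuousLinearMap.contDiff _).comp (contDiff_fst.clm_apply contDiff_const),
    fun _ => rfl⟩

/-- The matrix coefficients of the action of `Spin(n+1, 1)` on `S₊`, in a basis of `S₊`. -/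
def coeffSpinor (i j : Fin (Module.finrank ℝ (Spinor K))) :
    smoothFunctions (D.spin : Set ((Vec K →L[ℝ] Vec K) × (Spinor K →L[ℝ] Spinor K))) :=
  ⟨fun u => (Module.finBasis ℝ (Spinor K)).coord i (u.1.2 (Module.finBasis ℝ (Spinor K) j)),
    fun u => LinearMap.toContinuousLinearMap ((Module.finBasis ℝ (Spinor K)).coord i)
      (u.2 (Module.finBasis ℝ (Spinor K) j)),
    (ContinuousLinearMap.contDiff _).comp (contDiff_snd.clm_apply contDiff_const),
    fun _ => rfl⟩

/-- The action of an `A`-point `χ` of `Spin(n+1, 1)` on the `A`-points of the supertranslation group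
`T`: the matrix coefficients of the representation `V ⊕ S₊` are replaced by their values in `A₀`
under `χ`. -/
def spinAct (n : ℕ) (χ : D.SpinPts n) (x : D.supertranslation.Pts n) : D.supertranslation.Pts n :=
  ∑ i, ∑ j, χ (D.coeffVec i j) •
      D.supertranslation.linPts n (LinearMap.prodMap
        (((Module.finBasis ℝ (Vec K)).coord j).smulRight (Module.finBasis ℝ (Vec K) i)) 0)
        (D.prodMap_mem _ _) x
    + ∑ i, ∑ j, χ (D.coeffSpinor i j) •
      D.supertranslation.linPts n (LinearMap.prodMap 0
        (((Module.finBasis ℝ (Spinor K)).coord j).smulRight (Module.finBasis ℝ (Spinor K) i)))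
        (D.prodMap_mem _ _) x

end NormedDivisionAlgebra

end Super

/-! Everything rests on one fact: an action by automorphisms is linear in exponential coordinates.
On a line the Baker–Campbell–Hausdorff series reduces to addition (`expMul_smul_smul`), so an
automorphism commutes with multiplication by natural numbers. It is also differentiable at `0`, and
the difference quotients of `X / m` identify it with its derivative there (`act_eq_Ad`). Of the
group law of `H_A`, only this one-parameter law is needed.

The recursion for the simplices uses only products, inverses and real multiples, all of which a
linear automorphism preserves; this is equivariance (`simplex_map`). A linear automorphism that
preserves `ω_A` also preserves the left-invariant form (`form_map`). The two integrands therefore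
agree at each point of the simplex, and no change of variables is needed.

Smoothness and naturality of the integral are algebraic. By nilpotency the product is a polynomial
whose degree is bounded independently of `A`. Hence a simplex, as a function of its vertices `h` and
its parameter `t`, is a finite sum of terms `c(t) P(h)` with `c` smooth and `P` a smooth map of
supermanifolds (`separated_simplex`); the smoothing factor removes the singularity at the apex of
the cone. Such sums are stable under brackets, products, derivatives in `t` and differentials of
left translations. Multilinearity of `ω_A` then turns the integral into a real linear combination of
maps `ω_A(P₁, …, P_p)` (`isSupergroupCochain_integral`), so nothing is differentiated under the
integral sign.

For `Spin(n+1, 1)`, the norm identity of `𝕂` yields the Clifford relations, and these show that the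
generators preserve the inner product and the bracket of spinors (`dot_gammaMinus_gammaPlus`).
Written in matrix coefficients, these invariances are polynomial identities in the algebra of smooth
functions on the group. An `A`-point is an algebra homomorphism out of that algebra, so it carries
them over to `A₀` (`bracketAux_coeffMap`, `ext_coeffMap`). The linear arguments above then apply
directly to each `A`-point. -/

namespace Super

/-! ### Graded commutativity of the Grassmann algebra -/

theorem gr_ι_mul_ι {n : ℕ} (v w : Fin n → ℝ) :
    CliffordAlgebra.ι (0 : QuadraticForm ℝ (Fin n → ℝ)) v * CliffordAlgebra.ι _ w =
      -(CliffordAlgebra.ι _ w * CliffordAlgebra.ι _ v) :=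
  CliffordAlgebra.ι_mul_ι_comm_of_isOrtho (by simp [QuadraticMap.IsOrtho])

/-- Moving a pair of generators past a third changes the sign twice. These pairs generate the even
part, so centrality of the even part follows. -/
theorem gr_ι_mul_ι_commute {n : ℕ} (v w : Fin n → ℝ) (b : Gr n) :
    Commute (CliffordAlgebra.ι (0 : QuadraticForm ℝ (Fin n → ℝ)) v * CliffordAlgebra.ι _ w) b := by
  induction b using CliffordAlgebra.induction with
  | algebraMap r => exact Algebra.commute_algebraMap_right r _
  | ι u =>
    rw [Commute, SemiconjBy, mul_assoc, gr_ι_mul_ι w u, mul_neg, ← mul_assoc, gr_ι_mul_ι v u,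
      neg_mul, neg_neg, mul_assoc]
  | mul a b ha hb => exact ha.mul_right hb
  | add a b ha hb => exact ha.add_right hb

theorem grPart_zero_commute {n : ℕ} {a : Gr n} (ha : a ∈ grPart n 0) (b : Gr n) : Commute a b := by
  induction a, ha using CliffordAlgebra.even_induction with
  | algebraMap r => exact Algebra.commute_algebraMap_left r b
  | add x y hx hy h1 h2 => exact h1.add_left h2
  | ι_mul_ι_mul m₁ m₂ x hx h => exact (gr_ι_mul_ι_commute m₁ m₂ b).mul_left h

theorem gr0_commute {n : ℕ} (c : Gr0 n) (b : Gr n) : (c : Gr n) * b = b * c :=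
  grPart_zero_commute c.2 b

theorem grPart_one_anticommute {n : ℕ} {a b : Gr n} (ha : a ∈ grPart n 1) (hb : b ∈ grPart n 1) :
    a * b = -(b * a) := by
  induction a, ha using CliffordAlgebra.odd_induction with
  | ι v =>
    induction b, hb using CliffordAlgebra.odd_induction with
    | ι w => exact gr_ι_mul_ι v w
    | add x y hx hy h1 h2 => rw [mul_add, h1, h2, add_mul, neg_add]
    | ι_mul_ι_mul m₁ m₂ x hx h =>
      rw [← mul_assoc, ← (gr_ι_mul_ι_commute m₁ m₂ _).eq, mul_assoc, h, mul_neg]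
      simp only [mul_assoc]
  | add x y hx hy h1 h2 => rw [add_mul, h1, h2, mul_add, neg_add]
  | ι_mul_ι_mul m₁ m₂ x hx h =>
    rw [mul_assoc, h, mul_neg, ← mul_assoc, (gr_ι_mul_ι_commute m₁ m₂ b).eq, mul_assoc]

/-- The even part of a Grassmann algebra is commutative. -/
@[reducible] def gr0CommRing (n : ℕ) : CommRing (Gr0 n) :=
  { (inferInstance : Ring (Gr0 n)) with
    mul_comm := fun a b => Subtype.ext (gr0_commute a b) }

/-! ### The Lie algebra of points -/

section

variable {V : Type*} [AddCommGroup V] [Module ℝ V]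

theorem SuperVect.incl_smul (𝒱 : SuperVect V) {n : ℕ} (c : Gr0 n) (x : 𝒱.Pts n) :
    𝒱.incl n (c • x) = c • 𝒱.incl n x := rfl

instance (𝒱 : SuperVect V) (n : ℕ) : SMulCommClass ℝ (Gr0 n) (𝒱.Pts n) where
  smul_comm r c x := 𝒱.incl_injective n (by
    rw [map_smul, 𝒱.incl_smul, 𝒱.incl_smul, map_smul, smul_comm])

theorem gr0_smul_tmul {n : ℕ} (c : Gr0 n) (a : Gr n) (v : V) :
    c • (a ⊗ₜ[ℝ] v) = ((c : Gr n) * a) ⊗ₜ[ℝ] v := TensorProduct.smul_tmul' c a v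

/-- Homomorphisms of Grassmann algebras are linear on even parts. -/
def GrHom.evenLin {m n : ℕ} (f : GrHom m n) : Gr0 m →ₗ[ℝ] Gr0 n where
  toFun := f.even
  map_add' _ _ := Subtype.ext (map_add f.toAlgHom _ _)
  map_smul' r _ := Subtype.ext (map_smul f.toAlgHom r _)

variable (𝔥 : LieSuperalgebra V)

theorem LieSuperalgebra.bracketAux_smul_left {n : ℕ} (c : Gr0 n) (x y : Gr n ⊗[ℝ] V) :
    𝔥.bracketAux n (c • x) y = c • 𝔥.bracketAux n x y := by
  induction x using TensorProduct.induction_on with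
  | zero => simp
  | add x z hx hz => simp only [smul_add, map_add, LinearMap.add_apply, hx, hz]
  | tmul a v =>
    induction y using TensorProduct.induction_on with
    | zero => simp
    | add y z hy hz => simp only [smul_add, map_add, hy, hz]
    | tmul b w =>
      rw [gr0_smul_tmul, 𝔥.bracketAux_tmul, 𝔥.bracketAux_tmul, gr0_smul_tmul, ← mul_assoc,
        ← gr0_commute, mul_assoc]

theorem LieSuperalgebra.bracketAux_smul_right {n : ℕ} (c : Gr0 n) (x y : Gr n ⊗[ℝ] V) :
    𝔥.bracketAux n x (c • y) = c • 𝔥.bracketAux n x y := by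
  induction x using TensorProduct.induction_on with
  | zero => simp
  | add x z hx hz => simp only [smul_add, map_add, LinearMap.add_apply, hx, hz]
  | tmul a v =>
    induction y using TensorProduct.induction_on with
    | zero => simp
    | add y z hy hz => simp only [smul_add, map_add, hy, hz]
    | tmul b w =>
      rw [gr0_smul_tmul, 𝔥.bracketAux_tmul, 𝔥.bracketAux_tmul, gr0_smul_tmul, ← mul_assoc]

/-- The Koszul sign in the skew-symmetry of `𝔥` cancels the sign from exchanging the Grassmann
coefficients, because coefficient and vector have the same parity. -/
theorem LieSuperalgebra.bracketAux_skew {n : ℕ} {x y : Gr n ⊗[ℝ] V}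
    (hx : x ∈ Submodule.span ℝ (𝔥.gens n)) (hy : y ∈ Submodule.span ℝ (𝔥.gens n)) :
    𝔥.bracketAux n x y = -𝔥.bracketAux n y x := by
  induction hx using Submodule.span_induction with
  | mem x hx =>
    induction hy using Submodule.span_induction with
    | mem y hy =>
      obtain ⟨i, a, v, ha, hv, rfl⟩ := hx
      obtain ⟨j, b, w, hb, hw, rfl⟩ := hy
      rw [𝔥.bracketAux_tmul, 𝔥.bracketAux_tmul, 𝔥.skew hv hw, TensorProduct.tmul_neg,
        TensorProduct.tmul_smul, TensorProduct.smul_tmul']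
      congr 2
      have two : ∀ e : ZMod 2, e = 0 ∨ e = 1 := by decide
      rcases two i with rfl | rfl
      · rw [koszul, if_neg (by simp), one_smul, (grPart_zero_commute ha b).eq]
      · rcases two j with rfl | rfl
        · rw [koszul, if_neg (by simp), one_smul, (grPart_zero_commute hb a).eq]
        · rw [koszul, if_pos ⟨rfl, rfl⟩, grPart_one_anticommute hb ha, neg_smul, one_smul, neg_neg]
    | zero => simp
    | add y z _ _ hy hz => rw [map_add, map_add, LinearMap.add_apply, hy, hz, neg_add]
    | smul r y _ hy => rw [map_smul, map_smul, LinearMap.smul_apply, hy, smul_neg]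
  | zero => simp
  | add x z _ _ hx hz => rw [map_add, map_add, LinearMap.add_apply, hx, hz, neg_add]
  | smul r x _ hx => rw [map_smul, map_smul, LinearMap.smul_apply, hx, smul_neg]

/-- The bracket of `𝔥_A` as a bilinear map. -/
def LieSuperalgebra.bracketLin (n : ℕ) : 𝔥.Pts n →ₗ[ℝ] 𝔥.Pts n →ₗ[ℝ] 𝔥.Pts n :=
  LinearMap.mk₂ ℝ (𝔥.bracketPts n)
    (fun x x' y => 𝔥.incl_injective n (by
      change 𝔥.bracketAux n (𝔥.incl n (x + x')) (𝔥.incl n y) = _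
      rw [map_add, map_add, map_add]; rfl))
    (fun r x y => 𝔥.incl_injective n (by
      change 𝔥.bracketAux n (𝔥.incl n (r • x)) (𝔥.incl n y) = _
      rw [map_smul, map_smul, map_smul]; rfl))
    (fun x y y' => 𝔥.incl_injective n (by
      change 𝔥.bracketAux n (𝔥.incl n x) (𝔥.incl n (y + y')) = _
      rw [map_add, map_add, map_add]; rfl))
    (fun r x y => 𝔥.incl_injective n (by
      change 𝔥.bracketAux n (𝔥.incl n x) (𝔥.incl n (r • y)) = _
      rw [map_smul, map_smul, map_smul]; rfl))

theorem LieSuperalgebra.bracketLin_apply {n : ℕ} (x y : 𝔥.Pts n) :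
    𝔥.bracketLin n x y = 𝔥.bracketPts n x y := rfl

theorem LieSuperalgebra.bracketLin_smul_left {n : ℕ} (c : Gr0 n) (x y : 𝔥.Pts n) :
    𝔥.bracketLin n (c • x) y = c • 𝔥.bracketLin n x y :=
  𝔥.incl_injective n (𝔥.bracketAux_smul_left c _ _)

theorem LieSuperalgebra.bracketLin_smul_right {n : ℕ} (c : Gr0 n) (x y : 𝔥.Pts n) :
    𝔥.bracketLin n x (c • y) = c • 𝔥.bracketLin n x y :=
  𝔥.incl_injective n (𝔥.bracketAux_smul_right c _ _)

theorem LieSuperalgebra.bracketPts_self {n : ℕ} (x : 𝔥.Pts n) : 𝔥.bracketPts n x x = 0 := by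
  apply 𝔥.incl_injective n
  have h := 𝔥.bracketAux_skew (𝔥.incl_mem x) (𝔥.incl_mem x)
  rw [map_zero]
  have h2 : (2 : ℝ) • 𝔥.bracketAux n (𝔥.incl n x) (𝔥.incl n x) = 0 := by
    rw [two_smul]
    exact eq_neg_iff_add_eq_zero.1 h
  exact (smul_eq_zero.1 h2).resolve_left two_ne_zero

theorem LieSuperalgebra.mapPts_bracketPts {m n : ℕ} (f : GrHom m n) (x y : 𝔥.Pts m) :
    𝔥.mapPts f (𝔥.bracketPts m x y) = 𝔥.bracketPts n (𝔥.mapPts f x) (𝔥.mapPts f y) := by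
  apply 𝔥.incl_injective n
  change LinearMap.rTensor V f.toAlgHom.toLinearMap (𝔥.bracketAux m (𝔥.incl m x) (𝔥.incl m y)) =
    𝔥.bracketAux n (LinearMap.rTensor V f.toAlgHom.toLinearMap (𝔥.incl m x))
      (LinearMap.rTensor V f.toAlgHom.toLinearMap (𝔥.incl m y))
  generalize 𝔥.incl m x = x
  generalize 𝔥.incl m y = y
  induction x using TensorProduct.induction_on with
  | zero => simp
  | add x z hx hz => simp only [map_add, LinearMap.add_apply, hx, hz]
  | tmul a v =>
    induction y using TensorProduct.induction_on with
    | zero => simp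
    | add y z hy hz => simp only [map_add, hy, hz]
    | tmul b w => simp [𝔥.bracketAux_tmul]

/-! ### The Baker–Campbell–Hausdorff product -/

theorem bchWord_map {α β : Type*} (F : α → β) (X Y : α) {k : ℕ} (r s : Fin k → ℕ) :
    (bchWord X Y r s).map F = bchWord (F X) (F Y) r s := by
  simp [bchWord, List.map_flatten, List.map_ofFn, Function.comp_def]

theorem mem_bchWord {α : Type*} {X Y z : α} {k : ℕ} {r s : Fin k → ℕ}
    (h : z ∈ bchWord X Y r s) : z = X ∨ z = Y := by
  simp only [bchWord, List.mem_flatten, List.mem_ofFn] at h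
  obtain ⟨l, ⟨i, rfl⟩, h⟩ := h
  rcases List.mem_append.1 h with h | h
  · exact Or.inl (List.eq_of_mem_replicate h)
  · exact Or.inr (List.eq_of_mem_replicate h)

theorem length_bchWord {α : Type*} (X Y : α) {k : ℕ} (r s : Fin k → ℕ) :
    (bchWord X Y r s).length = ∑ i, (r i + s i) := by
  simp [bchWord, List.length_flatten, List.map_ofFn, List.sum_ofFn, Function.comp_def]

theorem LieSuperalgebra.nested_cons (n : ℕ) (x : 𝔥.Pts n) {l : List (𝔥.Pts n)} (hl : l ≠ []) :
    𝔥.nested n (x :: l) = 𝔥.bracketPts n x (𝔥.nested n l) := by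
  obtain ⟨y, l, rfl⟩ := List.exists_cons_of_ne_nil hl
  rfl

/-- The span of the `j`-fold nested brackets in `A ⊗ 𝔥`. -/
def LieSuperalgebra.deepSpan (n j : ℕ) : Submodule ℝ (Gr n ⊗[ℝ] V) :=
  Submodule.span ℝ {z | ∃ (a : Gr n) (l : List V) (x : V), l.length = j ∧
    z = a ⊗ₜ[ℝ] l.foldr (fun y z => 𝔥.bracket y z) x}

theorem LieSuperalgebra.bracketAux_mem_deepSpan {n j : ℕ} (x : Gr n ⊗[ℝ] V) {y : Gr n ⊗[ℝ] V}
    (hy : y ∈ 𝔥.deepSpan n j) : 𝔥.bracketAux n x y ∈ 𝔥.deepSpan n (j + 1) := by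
  induction hy using Submodule.span_induction with
  | mem y hy =>
    obtain ⟨b, l, w, hl, rfl⟩ := hy
    induction x using TensorProduct.induction_on with
    | zero => simp
    | add x z hx hz => rw [map_add, LinearMap.add_apply]; exact Submodule.add_mem _ hx hz
    | tmul a v =>
      rw [𝔥.bracketAux_tmul]
      exact Submodule.subset_span ⟨b * a, v :: l, w, by simp [hl], by simp⟩
  | zero => simp
  | add y z _ _ hy hz => rw [map_add]; exact Submodule.add_mem _ hy hz
  | smul r y _ hy => rw [map_smul]; exact Submodule.smul_mem _ r hy

/-- Nested brackets in `𝔥_A` are Grassmann combinations of equally deep nested brackets in `𝔥`. This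
lets one nilpotency bound serve all `A`. -/
theorem LieSuperalgebra.incl_nested_mem {n : ℕ} (l : List (𝔥.Pts n)) (x : 𝔥.Pts n) :
    𝔥.incl n (𝔥.nested n (l ++ [x])) ∈ 𝔥.deepSpan n l.length := by
  induction l with
  | nil =>
    change 𝔥.incl n x ∈ 𝔥.deepSpan n 0
    generalize 𝔥.incl n x = y
    induction y using TensorProduct.induction_on with
    | zero => simp
    | add x z hx hz => exact Submodule.add_mem _ hx hz
    | tmul a v => exact Submodule.subset_span ⟨a, [], v, rfl, rfl⟩
  | cons y l ih =>
    rw [List.cons_append, 𝔥.nested_cons n y (by simp)]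
    exact 𝔥.bracketAux_mem_deepSpan _ ih

variable {𝔥}

theorem LieSuperalgebra.IsNilpotent.exists_nested_eq_zero (h𝔥 : 𝔥.IsNilpotent) :
    ∃ k : ℕ, ∀ (n : ℕ) (l : List (𝔥.Pts n)), k < l.length → 𝔥.nested n l = 0 := by
  obtain ⟨k, hk⟩ := h𝔥
  refine ⟨k, fun n l hl => ?_⟩
  have hne : l ≠ [] := by rintro rfl; simp at hl
  have hbot : 𝔥.deepSpan n l.dropLast.length = ⊥ := by
    rw [LieSuperalgebra.deepSpan, Submodule.span_eq_bot]
    rintro z ⟨a, w, x, hw, rfl⟩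
    have hkw : k ≤ w.length := by rw [hw, List.length_dropLast]; omega
    -- The outermost `k` brackets already vanish, whatever element the remaining inner ones produce.
    rw [← List.take_append_drop k w, List.foldr_append, hk _ _ (by simpa using hkw),
      TensorProduct.tmul_zero]
  have hmem := 𝔥.incl_nested_mem l.dropLast (l.getLast hne)
  rw [List.dropLast_append_getLast, hbot, Submodule.mem_bot] at hmem
  exact 𝔥.incl_injective n (hmem.trans (map_zero _).symm)

/-- A term of degree `d` is a combination of nested brackets of words of length `d`. The bound `N`
does not depend on `A`, so the product is one polynomial formula for all Grassmann algebras. -/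
theorem LieSuperalgebra.IsNilpotent.exists_expMul_eq_sum (h𝔥 : 𝔥.IsNilpotent) :
    ∃ N : ℕ, ∀ (n : ℕ) (X Y : 𝔥.Pts n),
      𝔥.expMul n X Y = ∑ d ∈ Finset.range N, 𝔥.bchTerm n d X Y := by
  obtain ⟨k, hk⟩ := h𝔥.exists_nested_eq_zero
  refine ⟨k + 1, fun n X Y => ?_⟩
  refine finsum_eq_sum_of_support_subset _ fun d hd => ?_
  by_contra hlt
  refine hd ?_
  simp only [Finset.coe_range, Set.mem_Iio, not_lt] at hlt
  refine Finset.sum_eq_zero fun j _ => Finset.sum_eq_zero fun rs hrs => ?_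
  rw [hk n _ (by rw [length_bchWord, (Finset.mem_filter.1 hrs).2.2]; omega), smul_zero]

theorem LieSuperalgebra.map_nested {m n : ℕ} {φ : 𝔥.Pts m →ₗ[ℝ] 𝔥.Pts n}
    (hφ : ∀ x y, φ (𝔥.bracketPts m x y) = 𝔥.bracketPts n (φ x) (φ y)) (l : List (𝔥.Pts m)) :
    φ (𝔥.nested m l) = 𝔥.nested n (l.map φ) := by
  induction l with
  | nil => exact map_zero φ
  | cons x l ih =>
    by_cases hl : l = []
    · subst hl; rfl
    · rw [𝔥.nested_cons m x hl, hφ, ih, List.map_cons, 𝔥.nested_cons n _ (by simpa using hl)]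

theorem LieSuperalgebra.IsNilpotent.map_expMul (h𝔥 : 𝔥.IsNilpotent) {m n : ℕ}
    {φ : 𝔥.Pts m →ₗ[ℝ] 𝔥.Pts n}
    (hφ : ∀ x y, φ (𝔥.bracketPts m x y) = 𝔥.bracketPts n (φ x) (φ y)) (X Y : 𝔥.Pts m) :
    φ (𝔥.expMul m X Y) = 𝔥.expMul n (φ X) (φ Y) := by
  obtain ⟨N, hN⟩ := h𝔥.exists_expMul_eq_sum
  rw [hN, hN, map_sum]
  refine Finset.sum_congr rfl fun d _ => ?_
  simp only [LieSuperalgebra.bchTerm, map_sum, map_smul, LieSuperalgebra.map_nested hφ, bchWord_map]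

/-- The innermost bracket pairs two multiples of the same vector. -/
theorem LieSuperalgebra.nested_smul {n : ℕ} (X : 𝔥.Pts n) {l : List (𝔥.Pts n)}
    (hl : ∀ z ∈ l, ∃ r : ℝ, z = r • X) (h2 : 2 ≤ l.length) : 𝔥.nested n l = 0 := by
  induction l with
  | nil => simp at h2
  | cons x l ih =>
    have hne : l ≠ [] := by rintro rfl; simp at h2
    rw [𝔥.nested_cons n x hne]
    by_cases h3 : 2 ≤ l.length
    · rw [ih (fun z hz => hl z (List.mem_cons_of_mem _ hz)) h3]
      exact (𝔥.bracketLin n x).map_zero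
    · obtain ⟨y, rfl⟩ : ∃ y, l = [y] := by
        rw [← List.length_eq_one_iff]
        have := List.length_pos_iff.2 hne
        omega
      obtain ⟨r, rfl⟩ := hl x (by simp)
      obtain ⟨s, rfl⟩ := hl y (by simp)
      change 𝔥.bracketLin n (r • X) (s • X) = 0
      rw [map_smul, map_smul, LinearMap.smul_apply, bracketLin_apply, bracketPts_self, smul_zero,
        smul_zero]

theorem LieSuperalgebra.bchTerm_one (n : ℕ) (X Y : 𝔥.Pts n) : 𝔥.bchTerm n 1 X Y = X + Y := by
  have h : ((Finset.univ : Finset ((Fin 1 → Fin 2) × (Fin 1 → Fin 2))).filter fun rs =>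
      (∀ i, 0 < (rs.1 i : ℕ) + (rs.2 i : ℕ)) ∧ ∑ i, ((rs.1 i : ℕ) + (rs.2 i : ℕ)) = 1) =
      {(fun _ => 1, fun _ => 0), (fun _ => 0, fun _ => 1)} := by
    decide
  rw [LieSuperalgebra.bchTerm, Finset.Icc_self, Finset.sum_singleton]
  -- Only `k = 1` occurs in degree one. The exponents range over `Fin (1 + 1)`, restated as `Fin 2`
  -- so that the enumeration `h` applies.
  change ∑ rs ∈ ((Finset.univ : Finset ((Fin 1 → Fin 2) × (Fin 1 → Fin 2))).filter fun rs =>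
      (∀ i, 0 < (rs.1 i : ℕ) + (rs.2 i : ℕ)) ∧ ∑ i, ((rs.1 i : ℕ) + (rs.2 i : ℕ)) = 1), _ = _
  rw [h, Finset.sum_pair (by decide)]
  simp [bchWord, LieSuperalgebra.nested]

/-- The exponential of a line is a one-parameter subgroup. -/
theorem LieSuperalgebra.expMul_smul_smul {n : ℕ} (r s : ℝ) (X : 𝔥.Pts n) :
    𝔥.expMul n (r • X) (s • X) = (r + s) • X := by
  rw [LieSuperalgebra.expMul, finsum_eq_single _ 1, bchTerm_one, add_smul]
  intro d hd
  refine Finset.sum_eq_zero fun j hj => Finset.sum_eq_zero fun rs hrs => ?_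
  -- Degree `0` contributes nothing, since `Finset.Icc 1 0` is empty; any remaining term has degree
  -- at least two.
  have hd0 : 2 ≤ d := by
    have := Finset.mem_Icc.1 hj
    omega
  rw [LieSuperalgebra.nested_smul X, smul_zero]
  · intro z hz
    rcases mem_bchWord hz with rfl | rfl
    exacts [⟨r, rfl⟩, ⟨s, rfl⟩]
  · rw [length_bchWord, (Finset.mem_filter.1 hrs).2.2]
    exact hd0

end

/-! ### Closure properties of `A₀`-smooth maps -/

section A0Smooth

variable {n : ℕ} {E F G : Type*} [NormedAddCommGroup E] [NormedSpace ℝ E] [Module (Gr0 n) E]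
    [NormedAddCommGroup F] [NormedSpace ℝ F] [Module (Gr0 n) F]
    [NormedAddCommGroup G] [NormedSpace ℝ G] [Module (Gr0 n) G]

theorem A0SmoothOn.contDiff {f : E → F} (hf : A0SmoothOn n f Set.univ) :
    ContDiff ℝ ((⊤ : ℕ∞) : WithTop ℕ∞) f := contDiffOn_univ.1 hf.1

theorem A0SmoothOn.differentiable {f : E → F} (hf : A0SmoothOn n f Set.univ) :
    Differentiable ℝ f := hf.contDiff.differentiable (by simp)

theorem A0SmoothOn.of_fderiv_eq {f : E → F} {S : Set E}
    (hf : ContDiff ℝ ((⊤ : ℕ∞) : WithTop ℕ∞) f)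
    (h : ∀ x (a : Gr0 n) v, fderiv ℝ f x (a • v) = a • fderiv ℝ f x v) : A0SmoothOn n f S :=
  ⟨hf.contDiffOn, fun x _ => h x⟩

theorem a0SmoothOn_clm (f : E →L[ℝ] F) (h : ∀ (a : Gr0 n) v, f (a • v) = a • f v)
    (S : Set E) : A0SmoothOn n f S :=
  .of_fderiv_eq f.contDiff fun x a v => by rw [f.fderiv, h]

theorem A0SmoothOn.add {f g : E → F} (hf : A0SmoothOn n f Set.univ) (hg : A0SmoothOn n g Set.univ) :
    A0SmoothOn n (fun x => f x + g x) Set.univ :=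
  .of_fderiv_eq (hf.contDiff.add hg.contDiff) fun x a v => by
    rw [fderiv_fun_add (hf.differentiable x) (hg.differentiable x)]
    simp only [add_apply, hf.2 x trivial, hg.2 x trivial, smul_add]

theorem a0SmoothOn_zero : A0SmoothOn n (fun _ : E => (0 : F)) Set.univ :=
  .of_fderiv_eq contDiff_const fun x a v => by simp

theorem A0SmoothOn.const_smul [SMulCommClass ℝ (Gr0 n) F] {f : E → F}
    (hf : A0SmoothOn n f Set.univ) (r : ℝ) : A0SmoothOn n (fun x => r • f x) Set.univ :=
  .of_fderiv_eq (hf.contDiff.const_smul r) fun x a v => by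
    rw [fderiv_fun_const_smul (hf.differentiable x)]
    simp only [smul_apply, hf.2 x trivial, smul_comm]

theorem A0SmoothOn.sum {ι : Type*} {s : Finset ι} {f : ι → E → F}
    (hf : ∀ i ∈ s, A0SmoothOn n (f i) Set.univ) :
    A0SmoothOn n (fun x => ∑ i ∈ s, f i x) Set.univ := by
  classical
  induction s using Finset.induction_on with
  | empty => simpa using a0SmoothOn_zero
  | insert i s hi ih =>
    simp only [Finset.sum_insert hi]
    exact (hf i (by simp)).add (ih fun j hj => hf j (by simp [hj]))

theorem A0SmoothOn.bilinear {X : Type*} [NormedAddCommGroup X] [NormedSpace ℝ X] [Module (Gr0 n) X]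
    (B : E →L[ℝ] F →L[ℝ] G)
    (h₁ : ∀ (a : Gr0 n) x y, B (a • x) y = a • B x y)
    (h₂ : ∀ (a : Gr0 n) x y, B x (a • y) = a • B x y) {f : X → E} {g : X → F}
    (hf : A0SmoothOn n f Set.univ) (hg : A0SmoothOn n g Set.univ) :
    A0SmoothOn n (fun x => B (f x) (g x)) Set.univ :=
  .of_fderiv_eq ((B.contDiff.comp hf.contDiff).clm_apply hg.contDiff) fun x a v => by
    rw [B.fderiv_of_bilinear (hf.differentiable x) (hg.differentiable x)]
    change B (f x) (fderiv ℝ g x (a • v)) + B (fderiv ℝ f x (a • v)) (g x) =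
      a • (B (f x) (fderiv ℝ g x v) + B (fderiv ℝ f x v) (g x))
    rw [hf.2 x trivial, hg.2 x trivial, h₁, h₂, smul_add]

theorem A0SmoothOn.comp {f : F → G} {g : E → F} (hf : A0SmoothOn n f Set.univ)
    (hg : A0SmoothOn n g Set.univ) : A0SmoothOn n (fun x => f (g x)) Set.univ :=
  .of_fderiv_eq (hf.contDiff.comp hg.contDiff) fun x a v => by
    have := fderiv_comp x (hf.differentiable (g x)) (hg.differentiable x)
    rw [Function.comp_def] at this
    rw [this]
    simp only [ContinuousLinearMap.comp_apply, hf.2 _ trivial, hg.2 _ trivial]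

theorem a0SmoothOn_pi {ι : Type*} [Fintype ι] {f : ι → E → F}
    (hf : ∀ i, A0SmoothOn n (f i) Set.univ) :
    A0SmoothOn n (fun x i => f i x) Set.univ :=
  .of_fderiv_eq (contDiff_pi.2 fun i => (hf i).contDiff) fun x a v => by
    rw [fderiv_pi fun i => (hf i).differentiable x]
    ext i
    simp only [ContinuousLinearMap.coe_pi', Pi.smul_apply, (hf i).2 _ trivial]

theorem a0SmoothOn_apply {ι : Type*} [Fintype ι] (i : ι) :
    A0SmoothOn n (fun x : ι → E => x i) Set.univ :=
  a0SmoothOn_clm (ContinuousLinearMap.proj (R := ℝ) (φ := fun _ : ι => E) i)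
    (fun _ _ => rfl) _

/-- In a basis the map is a polynomial in the coordinates, which are continuous in finite dimension.
-/
theorem multilinear_continuous {ι : Type*} [Fintype ι] [FiniteDimensional ℝ E]
    (f : MultilinearMap ℝ (fun _ : ι => E) F) : Continuous f := by
  classical
  have h : (f : (ι → E) → F) = fun x => ∑ c : ι → Fin (Module.finrank ℝ E),
      (∏ k, (Module.finBasis ℝ E).coord (c k) (x k)) • f fun k => Module.finBasis ℝ E (c k) := by
    funext x
    conv_lhs => rw [show x = fun k => ∑ j, (Module.finBasis ℝ E).repr (x k) j • Module.finBasis ℝ E j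
      from funext fun k => ((Module.finBasis ℝ E).sum_repr (x k)).symm]
    rw [MultilinearMap.map_sum]
    exact Finset.sum_congr rfl fun c _ => by rw [MultilinearMap.map_smul_univ]; rfl
  rw [h]
  refine continuous_finsetSum _ fun c _ => Continuous.smul ?_ continuous_const
  exact continuous_finsetProd _ fun k _ =>
    (LinearMap.continuous_of_finiteDimensional _).comp (continuous_apply k)

/-- The derivative is the sum over the slots of the map with that slot replaced by the increment, so
`A₀`-linearity in each slot suffices. -/
theorem a0SmoothOn_multilinear {ι : Type*} [Fintype ι] [DecidableEq ι] [FiniteDimensional ℝ E]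
    (f : MultilinearMap ℝ (fun _ : ι => E) F)
    (h : ∀ x i (a : Gr0 n) v, f (Function.update x i (a • v)) = a • f (Function.update x i v))
    (S : Set (ι → E)) : A0SmoothOn n f S := by
  let f' : ContinuousMultilinearMap ℝ (fun _ : ι => E) F :=
    ⟨f, multilinear_continuous f⟩
  refine .of_fderiv_eq f'.contDiff fun x a v => ?_
  change fderiv ℝ f' x _ = a • fderiv ℝ f' x _
  rw [(f'.hasFDerivAt x).fderiv]
  simp only [ContinuousMultilinearMap.linearDeriv_apply, Finset.smul_sum]
  exact Finset.sum_congr rfl fun i _ => h x i a (v i)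

end A0Smooth

/-! ### Natural families of `A₀`-smooth maps -/

section

variable {V : Type*} [AddCommGroup V] [Module ℝ V] [FiniteDimensional ℝ V] (𝔥 : LieSuperalgebra V)
  {p q : ℕ}

/-- A smooth map of supermanifolds `Hᵖ → H`. -/
def LieSuperalgebra.NatSmooth (p : ℕ) (P : ∀ n, (Fin p → 𝔥.Pts n) → 𝔥.Pts n) : Prop :=
  (∀ {m n : ℕ} (f : GrHom m n) (h : Fin p → 𝔥.Pts m),
      P n (fun i => 𝔥.mapPts f (h i)) = 𝔥.mapPts f (P m h)) ∧
    ∀ n, A0SmoothOn n (P n) Set.univ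

variable {𝔥}

namespace LieSuperalgebra.NatSmooth

theorem proj (i : Fin p) : 𝔥.NatSmooth p fun _ h => h i :=
  ⟨fun _ _ => rfl, fun _ => a0SmoothOn_apply i⟩

theorem zero : 𝔥.NatSmooth p fun _ _ => 0 :=
  ⟨fun f _ => (map_zero (𝔥.mapPts f)).symm, fun _ => a0SmoothOn_zero⟩

theorem add {P Q : ∀ n, (Fin p → 𝔥.Pts n) → 𝔥.Pts n} (hP : 𝔥.NatSmooth p P)
    (hQ : 𝔥.NatSmooth p Q) : 𝔥.NatSmooth p fun n h => P n h + Q n h :=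
  ⟨fun f h => by simp only [hP.1, hQ.1, map_add], fun n => (hP.2 n).add (hQ.2 n)⟩

theorem smul {P : ∀ n, (Fin p → 𝔥.Pts n) → 𝔥.Pts n} (hP : 𝔥.NatSmooth p P) (r : ℝ) :
    𝔥.NatSmooth p fun n h => r • P n h :=
  ⟨fun f h => by simp only [hP.1, map_smul], fun n => (hP.2 n).const_smul r⟩

theorem sum {ι : Type*} {s : Finset ι} {P : ι → ∀ n, (Fin p → 𝔥.Pts n) → 𝔥.Pts n}
    (hP : ∀ i ∈ s, 𝔥.NatSmooth p (P i)) : 𝔥.NatSmooth p fun n h => ∑ i ∈ s, P i n h :=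
  ⟨fun f h => by rw [map_sum]; exact Finset.sum_congr rfl fun i hi => (hP i hi).1 f h,
    fun n => .sum fun i hi => (hP i hi).2 n⟩

theorem bracket {P Q : ∀ n, (Fin p → 𝔥.Pts n) → 𝔥.Pts n} (hP : 𝔥.NatSmooth p P)
    (hQ : 𝔥.NatSmooth p Q) : 𝔥.NatSmooth p fun n h => 𝔥.bracketPts n (P n h) (Q n h) :=
  ⟨fun f h => by simp only [hP.1, hQ.1, 𝔥.mapPts_bracketPts], fun n =>
    A0SmoothOn.bilinear (𝔥.bracketLin n).toContinuousBilinearMap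
      𝔥.bracketLin_smul_left 𝔥.bracketLin_smul_right (hP.2 n) (hQ.2 n)⟩

theorem comp {P : ∀ n, (Fin q → 𝔥.Pts n) → 𝔥.Pts n} (hP : 𝔥.NatSmooth q P)
    {Q : Fin q → ∀ n, (Fin p → 𝔥.Pts n) → 𝔥.Pts n} (hQ : ∀ i, 𝔥.NatSmooth p (Q i)) :
    𝔥.NatSmooth p fun n h => P n fun i => Q i n h :=
  ⟨fun f h => by rw [← hP.1]; exact congrArg (P _) (funext fun i => (hQ i).1 f h),
    fun n => (hP.2 n).comp (a0SmoothOn_pi fun i => (hQ i).2 n)⟩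

end LieSuperalgebra.NatSmooth

/-! ### Separated families -/

variable {T T' : Type*} [NormedAddCommGroup T] [NormedSpace ℝ T] [NormedAddCommGroup T']
  [NormedSpace ℝ T'] {s : Set T} {s' : Set T'}

variable (𝔥) in
/-- Families of maps `Hᵖ × s → H` that are finite sums of products of a smooth function on `s` and a
smooth map of supermanifolds `Hᵖ → H`. -/
def LieSuperalgebra.Separated (p : ℕ) (s : Set T)
    (f : ∀ n, (Fin p → 𝔥.Pts n) → T → 𝔥.Pts n) : Prop :=
  ∃ (ι : Type) (_ : Fintype ι) (c : ι → T → ℝ) (P : ι → ∀ n, (Fin p → 𝔥.Pts n) → 𝔥.Pts n),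
    (∀ j, ContDiffOn ℝ ((⊤ : ℕ∞) : WithTop ℕ∞) (c j) s) ∧ (∀ j, 𝔥.NatSmooth p (P j)) ∧
      ∀ n h, ∀ t ∈ s, f n h t = ∑ j, c j t • P j n h

namespace LieSuperalgebra.Separated

variable {f g : ∀ n, (Fin p → 𝔥.Pts n) → T → 𝔥.Pts n}

theorem congr (hf : 𝔥.Separated p s f) (h : ∀ n h, ∀ t ∈ s, g n h t = f n h t) :
    𝔥.Separated p s g := by
  obtain ⟨ι, _, c, P, hc, hP, hfe⟩ := hf
  exact ⟨ι, ‹_›, c, P, hc, hP, fun n x t ht => (h n x t ht).trans (hfe n x t ht)⟩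

theorem smul_natSmooth {c : T → ℝ} (hc : ContDiffOn ℝ ((⊤ : ℕ∞) : WithTop ℕ∞) c s)
    {P : ∀ n, (Fin p → 𝔥.Pts n) → 𝔥.Pts n} (hP : 𝔥.NatSmooth p P) :
    𝔥.Separated p s fun n h t => c t • P n h :=
  ⟨Unit, inferInstance, fun _ => c, fun _ => P, fun _ => hc, fun _ => hP, fun n h t _ => by simp⟩

theorem of_natSmooth {P : ∀ n, (Fin p → 𝔥.Pts n) → 𝔥.Pts n} (hP : 𝔥.NatSmooth p P) :
    𝔥.Separated p s fun n h _ => P n h :=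
  (smul_natSmooth (contDiffOn_const (c := 1)) hP).congr fun n h t _ => by simp

theorem zero : 𝔥.Separated p s fun _ _ _ => 0 := of_natSmooth .zero

theorem add (hf : 𝔥.Separated p s f) (hg : 𝔥.Separated p s g) :
    𝔥.Separated p s fun n h t => f n h t + g n h t := by
  obtain ⟨ι, _, c, P, hc, hP, hfe⟩ := hf
  obtain ⟨κ, _, d, Q, hd, hQ, hge⟩ := hg
  refine ⟨ι ⊕ κ, inferInstance, Sum.elim c d, Sum.elim P Q, ?_, ?_, fun n h t ht => ?_⟩
  · rintro (j | j); exacts [hc j, hd j]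
  · rintro (j | j); exacts [hP j, hQ j]
  · simp [hfe n h t ht, hge n h t ht]

theorem sum {ι : Type*} {u : Finset ι} {f : ι → ∀ n, (Fin p → 𝔥.Pts n) → T → 𝔥.Pts n}
    (hf : ∀ i ∈ u, 𝔥.Separated p s (f i)) : 𝔥.Separated p s fun n h t => ∑ i ∈ u, f i n h t := by
  classical
  induction u using Finset.induction_on with
  | empty => simpa using zero
  | insert i u hi ih =>
    simp only [Finset.sum_insert hi]
    exact (hf i (by simp)).add (ih fun j hj => hf j (by simp [hj]))

theorem smul (hf : 𝔥.Separated p s f) {c : T → ℝ}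
    (hc : ContDiffOn ℝ ((⊤ : ℕ∞) : WithTop ℕ∞) c s) :
    𝔥.Separated p s fun n h t => c t • f n h t := by
  obtain ⟨ι, _, d, P, hd, hP, hfe⟩ := hf
  refine ⟨ι, ‹_›, fun j t => c t * d j t, P, fun j => hc.mul (hd j), hP, fun n h t ht => ?_⟩
  simp only [hfe n h t ht, Finset.smul_sum, mul_smul]

theorem const_smul (hf : 𝔥.Separated p s f) (r : ℝ) :
    𝔥.Separated p s fun n h t => r • f n h t := hf.smul contDiffOn_const

theorem bracket (hf : 𝔥.Separated p s f) (hg : 𝔥.Separated p s g) :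
    𝔥.Separated p s fun n h t => 𝔥.bracketPts n (f n h t) (g n h t) := by
  obtain ⟨ι, _, c, P, hc, hP, hfe⟩ := hf
  obtain ⟨κ, _, d, Q, hd, hQ, hge⟩ := hg
  refine ⟨ι × κ, inferInstance, fun j t => c j.1 t * d j.2 t,
    fun j n h => 𝔥.bracketPts n (P j.1 n h) (Q j.2 n h),
    fun j => (hc _).mul (hd _), fun j => (hP _).bracket (hQ _), fun n h t ht => ?_⟩
  beta_reduce
  rw [hfe n h t ht, hge n h t ht, ← bracketLin_apply, Fintype.sum_prod_type_right]
  simp only [map_sum, LinearMap.sum_apply, map_smul, LinearMap.smul_apply, bracketLin_apply,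
    Finset.smul_sum,
    smul_smul, mul_comm]

theorem nested (l : List (∀ n, (Fin p → 𝔥.Pts n) → T → 𝔥.Pts n))
    (hl : ∀ f ∈ l, 𝔥.Separated p s f) :
    𝔥.Separated p s fun n h t => 𝔥.nested n (l.map fun f => f n h t) := by
  induction l with
  | nil => exact zero
  | cons f l ih =>
    by_cases hne : l = []
    · subst hne; exact hl f (by simp)
    · refine ((hl f (by simp)).bracket (ih fun g hg => hl g (by simp [hg]))).congr fun n h t _ => ?_
      rw [List.map_cons, 𝔥.nested_cons n _ (by simpa using hne)]

/-- The finite form of the series is a real combination of nested brackets. The number of its terms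
is uniform in `A`, so a single finite index set works for the whole family. -/
theorem expMul (h𝔥 : 𝔥.IsNilpotent) (hf : 𝔥.Separated p s f) (hg : 𝔥.Separated p s g) :
    𝔥.Separated p s fun n h t => 𝔥.expMul n (f n h t) (g n h t) := by
  obtain ⟨N, hN⟩ := h𝔥.exists_expMul_eq_sum
  simp only [hN, LieSuperalgebra.bchTerm]
  refine sum fun d _ => sum fun k _ => sum fun rs _ => const_smul ?_ _
  refine (nested (bchWord f g (fun i => (rs.1 i : ℕ)) fun i => (rs.2 i : ℕ)) ?_).congr
    fun n h t _ => by rw [bchWord_map]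
  intro e he
  rcases mem_bchWord he with rfl | rfl
  exacts [hf, hg]

theorem comp_param (hf : 𝔥.Separated p s f) {φ : T' → T}
    (hφ : ContDiffOn ℝ ((⊤ : ℕ∞) : WithTop ℕ∞) φ s') (hs : Set.MapsTo φ s' s) :
    𝔥.Separated p s' fun n h t => f n h (φ t) := by
  obtain ⟨ι, _, c, P, hc, hP, hfe⟩ := hf
  exact ⟨ι, ‹_›, fun j t => c j (φ t), P, fun j => (hc j).comp hφ hs, hP,
    fun n h t ht => hfe n h _ (hs ht)⟩

theorem comp_natSmooth (hf : 𝔥.Separated p s f)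
    {Q : Fin p → ∀ n, (Fin q → 𝔥.Pts n) → 𝔥.Pts n} (hQ : ∀ i, 𝔥.NatSmooth q (Q i)) :
    𝔥.Separated q s fun n h t => f n (fun i => Q i n h) t := by
  obtain ⟨ι, _, c, P, hc, hP, hfe⟩ := hf
  exact ⟨ι, ‹_›, c, fun j n h => P j n fun i => Q i n h, hc, fun j => (hP j).comp hQ,
    fun n h t ht => hfe n _ _ ht⟩

theorem natSmooth_apply (hf : 𝔥.Separated p s f) {t : T} (ht : t ∈ s) :
    𝔥.NatSmooth p fun n h => f n h t := by
  obtain ⟨ι, _, c, P, hc, hP, hfe⟩ := hf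
  simp only [hfe _ _ t ht]
  exact .sum fun j _ => (hP j).smul _

theorem differentiableOn (hf : 𝔥.Separated p s f) (n : ℕ) (h : Fin p → 𝔥.Pts n) :
    DifferentiableOn ℝ (f n h) s := by
  obtain ⟨ι, _, c, P, hc, hP, hfe⟩ := hf
  refine DifferentiableOn.congr (f := fun t => ∑ j, c j t • P j n h) ?_ (hfe n h)
  exact DifferentiableOn.fun_sum fun j _ =>
    ((hc j).differentiableOn (by simp)).smul_const (P j n h)

/-- Differentiation in the parameter affects only the real coefficients; the maps `P j` stay the
same. -/
theorem fderivWithin (hf : 𝔥.Separated p s f) (hs : UniqueDiffOn ℝ s) (v : T) :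
    𝔥.Separated p s fun n h t => fderivWithin ℝ (f n h) s t v := by
  obtain ⟨ι, _, c, P, hc, hP, hfe⟩ := hf
  refine ⟨ι, ‹_›, fun j t => _root_.fderivWithin ℝ (c j) s t v, P, fun j => ?_, hP,
    fun n h t ht => ?_⟩
  · exact ((hc j).fderivWithin hs (m := ((⊤ : ℕ∞) : WithTop ℕ∞)) (by simp)).clm_apply
      contDiffOn_const
  · beta_reduce
    rw [fderivWithin_congr (hfe n h) (hfe n h t ht)]
    have hd : ∀ j, HasFDerivWithinAt (fun t => c j t • P j n h)
        ((_root_.fderivWithin ℝ (c j) s t).smulRight (P j n h)) s t := fun j =>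
      (((hc j).differentiableOn (by simp)) t ht).hasFDerivWithinAt.smul_const _
    rw [(HasFDerivWithinAt.fun_sum fun j _ => hd j).fderivWithin (hs t ht)]
    simp

end LieSuperalgebra.Separated

/-- Obtained from the parametrized version by adding a dummy real parameter and evaluating it at
`0`. -/
theorem LieSuperalgebra.IsNilpotent.natSmooth_expMul (h𝔥 : 𝔥.IsNilpotent)
    {P Q : ∀ n, (Fin p → 𝔥.Pts n) → 𝔥.Pts n} (hP : 𝔥.NatSmooth p P) (hQ : 𝔥.NatSmooth p Q) :
    𝔥.NatSmooth p fun n h => 𝔥.expMul n (P n h) (Q n h) :=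
  (LieSuperalgebra.Separated.expMul (T := ℝ) (s := Set.univ) h𝔥 (.of_natSmooth hP)
    (.of_natSmooth hQ)).natSmooth_apply (Set.mem_univ 0)

theorem LieSuperalgebra.IsNilpotent.differentiable_expMul (h𝔥 : 𝔥.IsNilpotent) (n : ℕ)
    (X : 𝔥.Pts n) : Differentiable ℝ fun k => 𝔥.expMul n X k := by
  have h := (h𝔥.natSmooth_expMul (LieSuperalgebra.NatSmooth.proj (𝔥 := 𝔥) (0 : Fin 2))
    (LieSuperalgebra.NatSmooth.proj 1)).2 n
  have h2 : Differentiable ℝ fun k : 𝔥.Pts n => (![X, k] : Fin 2 → 𝔥.Pts n) := by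
    rw [differentiable_pi]
    intro i
    fin_cases i
    · exact differentiable_const X
    · exact differentiable_id
  have h3 := h.differentiable.comp h2
  exact h3

namespace LieSuperalgebra.Separated

variable {f g : ∀ n, (Fin p → 𝔥.Pts n) → T → 𝔥.Pts n}

/-- The differential of left translation by `f`, taken at `g` along `v`, is the derivative at `r =
0` of the product of `f` and `g + r v`. With `r` as an additional parameter this product is
separated, so the claim reduces to stability under parameter derivatives. It makes the arguments of
the left-invariant form separated. -/
theorem fderiv_expMul (h𝔥 : 𝔥.IsNilpotent) (hs : UniqueDiffOn ℝ s)
    {v : ∀ n, (Fin p → 𝔥.Pts n) → T → 𝔥.Pts n} (hf : 𝔥.Separated p s f) (hg : 𝔥.Separated p s g)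
    (hv : 𝔥.Separated p s v) :
    𝔥.Separated p s fun n h t =>
      fderiv ℝ (fun k => 𝔥.expMul n (f n h t) k) (g n h t) (v n h t) := by
  have hfst : ∀ {e : ∀ n, (Fin p → 𝔥.Pts n) → T → 𝔥.Pts n}, 𝔥.Separated p s e →
      𝔥.Separated p (s ×ˢ (Set.univ : Set ℝ)) fun n h z => e n h z.1 := fun he =>
    he.comp_param contDiffOn_fst fun z hz => hz.1
  have hF : 𝔥.Separated p (s ×ˢ (Set.univ : Set ℝ)) fun n h z =>
      𝔥.expMul n (f n h z.1) (g n h z.1 + z.2 • v n h z.1) :=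
    expMul h𝔥 (hfst hf) ((hfst hg).add ((hfst hv).smul contDiffOn_snd))
  have hu : UniqueDiffOn ℝ (s ×ˢ (Set.univ : Set ℝ)) := hs.prod uniqueDiffOn_univ
  refine ((hF.fderivWithin hu (0, 1)).comp_param (s' := s) (φ := fun t => (t, (0 : ℝ)))
    (contDiffOn_id.prodMk contDiffOn_const) fun t ht => ⟨ht, trivial⟩).congr fun n h t ht => ?_
  have h1 : HasDerivAt (fun r : ℝ => 𝔥.expMul n (f n h t) (g n h t + r • v n h t))
      (fderiv ℝ (fun k => 𝔥.expMul n (f n h t) k) (g n h t) (v n h t)) 0 := by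
    have hl : HasDerivAt (fun r : ℝ => g n h t + r • v n h t) (v n h t) 0 := by
      simpa using ((hasDerivAt_id (0 : ℝ)).smul_const (v n h t)).const_add (g n h t)
    have ho := (h𝔥.differentiable_expMul n (f n h t) (g n h t)).hasFDerivAt
    exact HasFDerivAt.comp_hasDerivAt_of_eq (0 : ℝ) ho hl (by simp)
  -- The chain rule is applied within `s × ℝ`: the families are controlled only over `s`, but the
  -- line `{t} × ℝ` stays inside the product.
  have h2 := (hF.differentiableOn n h (t, 0) ⟨ht, trivial⟩).hasFDerivWithinAt
  have hl : HasDerivWithinAt (fun r : ℝ => (t, r)) ((0 : T), (1 : ℝ)) Set.univ 0 :=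
    ((hasDerivAt_const (0 : ℝ) t).prodMk (hasDerivAt_id (0 : ℝ))).hasDerivWithinAt
  have h3 := h2.comp_hasDerivWithinAt (0 : ℝ) hl fun r _ => ⟨ht, trivial⟩
  exact h1.unique (hasDerivWithinAt_univ.1 h3)

end LieSuperalgebra.Separated

end

/-! ### Products in the Grassmann algebra -/

/-- The Grassmann algebra as an algebra over its even part. -/
@[reducible] def grAlgebraGr0 (n : ℕ) : @Algebra (Gr0 n) (Gr n) (gr0CommRing n).toCommSemiring _ :=
  letI := gr0CommRing n
  RingHom.toAlgebra' (CliffordAlgebra.even (0 : QuadraticForm ℝ (Fin n → ℝ))).val.toRingHom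
    fun c x => gr0_commute c x

/-- Even elements are central, so the ordered product is multilinear over the commutative ring `A₀`
even though `A` is not commutative. -/
theorem gr_prod_ofFn_update_mul {n p : ℕ} (a : Fin p → Gr n) (i : Fin p) (c : Gr0 n) (b : Gr n) :
    (List.ofFn (Function.update a i ((c : Gr n) * b))).prod =
      (c : Gr n) * (List.ofFn (Function.update a i b)).prod := by
  let := gr0CommRing n
  let := grAlgebraGr0 n
  exact (MultilinearMap.mkPiAlgebraFin (Gr0 n) p (Gr n)).map_update_smul a i c b

theorem gr_prod_ofFn_mul {n p : ℕ} (a : Fin p → Gr n) (c : Fin p → Gr0 n) :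
    (List.ofFn fun k => (c k : Gr n) * a k).prod =
      ((letI := gr0CommRing n; ∏ k, c k : Gr0 n) : Gr n) * (List.ofFn a).prod := by
  let := gr0CommRing n
  let := grAlgebraGr0 n
  exact (MultilinearMap.mkPiAlgebraFin (Gr0 n) p (Gr n)).map_smul_univ c a

section

variable {V : Type*} [AddCommGroup V] [Module ℝ V] {p q : ℕ}

theorem SuperVect.incl_update [DecidableEq (Fin p)] (𝒱 : SuperVect V) (n : ℕ)
    (x : Fin p → 𝒱.Pts n) (i : Fin p) (y : 𝒱.Pts n) :
    (fun k => 𝒱.incl n (Function.update x i y k)) =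
      Function.update (fun k => 𝒱.incl n (x k)) i (𝒱.incl n y) := by
  funext k
  exact Function.apply_update (fun _ => 𝒱.incl n) x i y k

variable [FiniteDimensional ℝ V] {𝔥 : LieSuperalgebra V}

/-! ### Cochains on points -/

namespace EvenCochain

theorem ext_apply (ω : EvenCochain 𝔥 p) (n : ℕ) (x : Fin p → Gr n ⊗[ℝ] V) :
    ω.ext n x = ∑ c : Fin p → Fin (Module.finrank ℝ V),
      ω.toMap (fun k => Module.finBasis ℝ V (c k)) • (List.ofFn fun k : Fin p =>
        TensorProduct.rid ℝ (Gr n)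
          (LinearMap.lTensor (Gr n) ((Module.finBasis ℝ V).coord (c k.rev)) (x k.rev))).prod := by
  simp [EvenCochain.ext, MultilinearMap.domDomCongr_apply]

theorem ext_update_smul (ω : EvenCochain 𝔥 p) (n : ℕ) (x : Fin p → Gr n ⊗[ℝ] V) (i : Fin p)
    (c : Gr0 n) (y : Gr n ⊗[ℝ] V) :
    ω.ext n (Function.update x i (c • y)) = (c : Gr n) * ω.ext n (Function.update x i y) := by
  rw [ext_apply, ext_apply, Finset.mul_sum]
  refine Finset.sum_congr rfl fun d _ => ?_
  rw [mul_smul_comm]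
  congr 1
  let L : Fin p → Gr n ⊗[ℝ] V →ₗ[ℝ] Gr n := fun k =>
    (TensorProduct.rid ℝ (Gr n)).toLinearMap ∘ₗ
      LinearMap.lTensor (Gr n) ((Module.finBasis ℝ V).coord (d k))
  have hL : ∀ k y, L k (c • y) = (c : Gr n) * L k y := by
    intro k y
    induction y using TensorProduct.induction_on with
    | zero => simp
    | add y z hy hz => rw [smul_add, map_add, hy, hz, map_add, mul_add]
    | tmul a v => rw [gr0_smul_tmul]; simp [L]
  -- The product `a_p ⋯ a₁` runs in reverse order, so slot `i` is its factor at position `i.rev`.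
  have hu : ∀ z, (fun k : Fin p => L k.rev (Function.update x i z k.rev)) =
      Function.update (fun k : Fin p => L k.rev (x k.rev)) i.rev (L i z) := by
    intro z
    funext k
    by_cases hk : k = i.rev
    · subst hk; simp
    · rw [Function.update_of_ne hk, Function.update_of_ne fun h => hk (by rw [← h, Fin.rev_rev])]
  change (List.ofFn fun k : Fin p => L k.rev (Function.update x i (c • y) k.rev)).prod = (c : Gr n) *
    (List.ofFn fun k : Fin p => L k.rev (Function.update x i y k.rev)).prod
  rw [hu, hu, hL, gr_prod_ofFn_update_mul]

theorem ext_map (ω : EvenCochain 𝔥 p) {m n : ℕ} (f : GrHom m n) (x : Fin p → Gr m ⊗[ℝ] V) :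
    ω.ext n (fun k => LinearMap.rTensor V f.toAlgHom.toLinearMap (x k)) =
      f.toAlgHom (ω.ext m x) := by
  have hL : ∀ (d : V →ₗ[ℝ] ℝ) (y : Gr m ⊗[ℝ] V), TensorProduct.rid ℝ (Gr n)
      (LinearMap.lTensor (Gr n) d (LinearMap.rTensor V f.toAlgHom.toLinearMap y)) =
      f.toAlgHom (TensorProduct.rid ℝ (Gr m) (LinearMap.lTensor (Gr m) d y)) := by
    intro d y
    induction y using TensorProduct.induction_on with
    | zero => simp
    | add y z hy hz => simp only [map_add, hy, hz]
    | tmul a v => simp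
  simp only [ext_apply, hL, map_sum, map_smul, map_list_prod, List.map_ofFn, Function.comp_def]

theorem onPts_mapPts (ω : EvenCochain 𝔥 p) {m n : ℕ} (f : GrHom m n) (x : Fin p → 𝔥.Pts m) :
    ω.onPts n (fun k => 𝔥.mapPts f (x k)) = f.even (ω.onPts m x) :=
  Subtype.ext (ω.ext_map f fun k => 𝔥.incl m (x k))

/-- The cochain `ω_A` as a multilinear map. -/
def onPtsLin (ω : EvenCochain 𝔥 p) (n : ℕ) : MultilinearMap ℝ (fun _ : Fin p => 𝔥.Pts n) (Gr0 n) where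
  toFun := ω.onPts n
  map_update_add' x i y z := Subtype.ext (by
    simp only [EvenCochain.onPts, SuperVect.incl_update, map_add, MultilinearMap.map_update_add]; rfl)
  map_update_smul' x i r y := Subtype.ext (by
    simp only [EvenCochain.onPts, SuperVect.incl_update, map_smul, MultilinearMap.map_update_smul]; rfl)

theorem onPts_update_smul (ω : EvenCochain 𝔥 p) (n : ℕ) (x : Fin p → 𝔥.Pts n) (i : Fin p)
    (c : Gr0 n) (y : 𝔥.Pts n) :
    ω.onPts n (Function.update x i (c • y)) = c • ω.onPts n (Function.update x i y) :=
  Subtype.ext (by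
    simp only [EvenCochain.onPts, SuperVect.incl_update, SuperVect.incl_smul, ext_update_smul]; rfl)

theorem onPts_a0SmoothOn (ω : EvenCochain 𝔥 p) (n : ℕ) : A0SmoothOn n (ω.onPts n) Set.univ :=
  a0SmoothOn_multilinear (ω.onPtsLin n) (fun x i a v => ω.onPts_update_smul n x i a v) _

theorem isSupergroupCochain_onPts (ω : EvenCochain 𝔥 p)
    {P : Fin p → ∀ n, (Fin q → 𝔥.Pts n) → 𝔥.Pts n} (hP : ∀ i, 𝔥.NatSmooth q (P i)) :
    IsSupergroupCochain 𝔥 q fun n h => ω.onPts n fun i => P i n h :=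
  ⟨fun f h => by simp only [(hP _).1, onPts_mapPts],
    fun n => (ω.onPts_a0SmoothOn n).comp (a0SmoothOn_pi fun i => (hP i).2 n)⟩

end EvenCochain

instance (n : ℕ) : SMulCommClass ℝ (Gr0 n) (Gr0 n) where
  smul_comm r a b := Subtype.ext (mul_smul_comm r (a : Gr n) (b : Gr n)).symm

theorem IsSupergroupCochain.sum_smul {ι : Type*} {u : Finset ι} (r : ι → ℝ)
    {F : ι → ∀ n, (Fin p → 𝔥.Pts n) → Gr0 n} (hF : ∀ i ∈ u, IsSupergroupCochain 𝔥 p (F i)) :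
    IsSupergroupCochain 𝔥 p fun n h => ∑ i ∈ u, r i • F i n h := by
  refine ⟨fun f h => ?_, fun n => .sum fun i hi => ((hF i hi).2 n).const_smul _⟩
  change _ = f.evenLin _
  rw [map_sum]
  refine Finset.sum_congr rfl fun i hi => ?_
  rw [map_smul, (hF i hi).1 f]
  rfl

/-! ### The corner -/

theorem isClosed_corner (p : ℕ) : IsClosed (corner p) := by
  have h1 : IsClosed {t : Fin p → ℝ | ∀ i, 0 ≤ t i} := by
    simp only [Set.ofPred_forall]
    exact isClosed_iInter fun i => isClosed_le continuous_const (continuous_apply i)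
  exact h1.inter (isClosed_le (continuous_finsetSum _ fun i _ => continuous_apply i) continuous_const)

theorem isCompact_corner (p : ℕ) : IsCompact (corner p) := by
  refine (isCompact_Icc (a := (0 : Fin p → ℝ)) (b := 1)).of_isClosed_subset (isClosed_corner p) ?_
  intro t ht
  refine ⟨fun i => ht.1 i, fun i => le_trans ?_ ht.2⟩
  exact Finset.single_le_sum (f := t) (fun j _ => ht.1 j) (Finset.mem_univ i)

theorem convex_corner (p : ℕ) : Convex ℝ (corner p) := by
  intro t ht u hu a b ha hb hab
  refine ⟨fun i => add_nonneg (mul_nonneg ha (ht.1 i)) (mul_nonneg hb (hu.1 i)), ?_⟩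
  simp only [Pi.add_apply, Pi.smul_apply, smul_eq_mul, Finset.sum_add_distrib, ← Finset.mul_sum]
  nlinarith [mul_le_mul_of_nonneg_left ht.2 ha, mul_le_mul_of_nonneg_left hu.2 hb]

theorem uniqueDiffOn_corner (p : ℕ) : UniqueDiffOn ℝ (corner p) := by
  refine uniqueDiffOn_convex (convex_corner p) ?_
  have h1 : IsOpen {t : Fin p → ℝ | ∀ i, 0 < t i} := by
    simp only [Set.ofPred_forall]
    exact isOpen_iInter_of_finite fun i => isOpen_lt continuous_const (continuous_apply i)
  have h2 : IsOpen {t : Fin p → ℝ | ∑ i, t i < 1} :=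
    isOpen_lt (continuous_finsetSum _ fun i _ => continuous_apply i) continuous_const
  -- The barycentre: its coordinates are positive and their sum `p / (p + 1)` is less than one, also
  -- when `p = 0`.
  refine ⟨fun _ => 1 / ((p : ℝ) + 1), mem_interior.2 ⟨_, ?_, h1.inter h2, fun i => ?_, ?_⟩⟩
  · exact fun t ht => ⟨fun i => (ht.1 i).le, le_of_lt ht.2⟩
  · positivity
  · simp only [Set.mem_ofPred_eq, Finset.sum_const, Finset.card_univ, Fintype.card_fin,
      nsmul_eq_mul, mul_one_div]
    rw [div_lt_one (by positivity)]
    linarith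

/-! ### Integrated cochains are supergroup cochains -/

/-- Each argument of `ω_A` in the integrand is a sum of terms `c(t) P(h)`. By multilinearity the
dependence on `t` collects into real functions, whose integrals are constants independent of `A` and
`h`. What remains is a finite real combination of natural `A₀`-smooth maps. -/
theorem EvenCochain.isSupergroupCochain_integral (h𝔥 : 𝔥.IsNilpotent) (ω : EvenCochain 𝔥 p)
    {S : ∀ n, (Fin q → 𝔥.Pts n) → (Fin (p + 1) → ℝ) → 𝔥.Pts n}
    (hS : 𝔥.Separated q (corner p) fun n h t => S n h (bary t)) :
    IsSupergroupCochain 𝔥 q fun n h => ω.integral n (S n h) := by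
  have hinv : 𝔥.Separated q (corner p) fun n h t => 𝔥.expInv n (S n h (bary t)) :=
    (hS.const_smul (-1)).congr fun n h t _ => by simp [LieSuperalgebra.expInv]
  have hv := fun i : Fin p => LieSuperalgebra.Separated.fderiv_expMul h𝔥 (uniqueDiffOn_corner p)
    hinv hS (hS.fderivWithin (uniqueDiffOn_corner p) (Pi.single i 1))
  -- Each slot `i` has its own index set `ι i`; a choice `J` of one term in every slot indexes the
  -- expanded sum.
  choose ι hι c P hc hP he using hv
  have key : ∀ n h, ω.integral n (S n h) = ∑ J : ∀ i, ι i,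
      (∫ t in corner p, ∏ i, c i (J i) t) • ω.onPts n fun i => P i (J i) n h := by
    intro n h
    have hint : ∀ J : ∀ i, ι i, MeasureTheory.IntegrableOn
        (fun t => (∏ i, c i (J i) t)) (corner p) MeasureTheory.volume := fun J =>
      ContinuousOn.integrableOn_compact (isCompact_corner p)
        (continuousOn_finsetProd _ fun i _ => (hc i (J i)).continuousOn)
    rw [EvenCochain.integral, MeasureTheory.setIntegral_congr_fun (isClosed_corner p).measurableSet
      (g := fun t => ∑ J : ∀ i, ι i, (∏ i, c i (J i) t) • ω.onPts n fun i => P i (J i) n h),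
      MeasureTheory.integral_finsetSum _ fun J _ => (hint J).smul_const _]
    · exact Finset.sum_congr rfl fun J _ => integral_smul_const _ _
    · intro t ht
      change ω.onPts n _ = _
      simp only [he _ n h t ht]
      change ω.onPtsLin n _ = _
      rw [MultilinearMap.map_sum]
      exact Finset.sum_congr rfl fun J _ => MultilinearMap.map_smul_univ _ _ _
  simp only [key]
  exact .sum_smul _ fun J _ => ω.isSupergroupCochain_onPts fun i => hP i (J i)

/-! ### Standard simplices are smooth -/

/-- The quotients `t i.succ / ∑ i, t i` are singular only at the apex `∑ i, t i = 0`. Near it the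
factor `ℓ` vanishes identically, so the coefficients extend smoothly by zero. -/
theorem LieSuperalgebra.Separated.smoothing_smul {ℓ : ℝ → ℝ} (hℓ : IsSmoothingFactor ℓ)
    {f : ∀ n, (Fin q → 𝔥.Pts n) → (Fin p → ℝ) → 𝔥.Pts n} (hf : 𝔥.Separated q (corner p) f) :
    𝔥.Separated q (corner (p + 1)) fun n h t =>
      ℓ (∑ i, t i) • f n h fun i => t i.succ / ∑ i, t i := by
  obtain ⟨hsm, -, ⟨ε, hε, hz⟩, -⟩ := hℓ
  -- This includes the apex, where division by zero gives the origin of `corner p`.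
  have hmaps : Set.MapsTo (fun (t : Fin (p + 1) → ℝ) (i : Fin p) => t i.succ / ∑ i, t i)
      (corner (p + 1)) (corner p) := by
    intro t ht
    have hs : 0 ≤ ∑ i, t i := Finset.sum_nonneg fun i _ => ht.1 i
    refine ⟨fun i => div_nonneg (ht.1 _) hs, ?_⟩
    rw [← Finset.sum_div]
    refine div_le_one_of_le₀ ?_ hs
    rw [Fin.sum_univ_succ]
    linarith [ht.1 0]
  obtain ⟨ι, _, c, P, hc, hP, hfe⟩ := hf
  refine ⟨ι, ‹_›, fun j t => ℓ (∑ i, t i) * c j fun i => t i.succ / ∑ i, t i, P, fun j => ?_, hP,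
    fun n h t ht => ?_⟩
  · intro t ht
    have hsum : ContDiff ℝ ((⊤ : ℕ∞) : WithTop ℕ∞) fun t : Fin (p + 1) → ℝ => ∑ i, t i :=
      ContDiff.sum fun i _ => contDiff_apply ℝ ℝ i
    have hI : Set.MapsTo (fun t : Fin (p + 1) → ℝ => ∑ i, t i) (corner (p + 1)) (Set.Icc 0 1) :=
      fun t ht => ⟨Finset.sum_nonneg fun i _ => ht.1 i, ht.2⟩
    by_cases hlt : ∑ i, t i < ε
    · refine (contDiffWithinAt_const (c := (0 : ℝ))).congr_of_eventuallyEq ?_ ?_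
      · have : ∀ᶠ u in nhdsWithin t (corner (p + 1)), ∑ i, u i < ε :=
          nhdsWithin_le_nhds (hsum.continuous.continuousAt.eventually_lt continuousAt_const hlt)
        filter_upwards [this, self_mem_nhdsWithin] with u hu hu'
        rw [hz (∑ i, u i) (hI hu') hu, zero_mul]
      · beta_reduce
        rw [hz (∑ i, t i) (hI ht) hlt, zero_mul]
    · have hne : ∑ i, t i ≠ 0 := (hε.trans_le (not_lt.1 hlt)).ne'
      refine ((hsm.comp hsum.contDiffOn hI) t ht).mul (ContDiffWithinAt.comp t
        (hc j _ (hmaps ht)) ?_ hmaps)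
      exact contDiffWithinAt_pi.2 fun i =>
        ((contDiff_apply ℝ ℝ i.succ).contDiffAt.div hsum.contDiffAt hne).contDiffWithinAt
  · simp only [hfe n h _ (hmaps ht), Finset.smul_sum, mul_smul]

theorem LieSuperalgebra.IsNilpotent.separated_simplex (h𝔥 : 𝔥.IsNilpotent) {ℓ : ℝ → ℝ}
    (hℓ : IsSmoothingFactor ℓ) (p : ℕ) :
    𝔥.Separated (p + 1) (corner p) fun n h t => 𝔥.simplex n ℓ p h (bary t) := by
  induction p with
  | zero => exact .of_natSmooth (.proj 0)
  | succ p ih =>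
    have hb : ∀ i : Fin (p + 1), 𝔥.NatSmooth (p + 2) fun n h =>
        𝔥.expMul n (𝔥.expInv n (h 0)) (h i.succ) := fun i => by
      have h0 : 𝔥.NatSmooth (p + 2) fun n h => (-1 : ℝ) • h 0 :=
        (LieSuperalgebra.NatSmooth.proj 0).smul (-1)
      simp only [neg_one_smul] at h0
      exact h𝔥.natSmooth_expMul h0 (.proj i.succ)
    refine (LieSuperalgebra.Separated.expMul h𝔥 (.of_natSmooth (.proj 0))
      ((ih.comp_natSmooth hb).smoothing_smul hℓ)).congr fun n h t ht => ?_
    have h1 : 1 - bary t 0 = ∑ i, t i := by simp [bary]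
    rw [LieSuperalgebra.simplex, h1]
    congr 1
    -- At the apex the coordinates of the base point are not barycentric, but both sides are
    -- multiplied by `ℓ 0 = 0`.
    by_cases hs : ∑ i, t i = 0
    · obtain ⟨-, -, ⟨ε, hε, hz⟩, -⟩ := hℓ
      rw [hs, hz 0 (by simp) hε, zero_smul, zero_smul]
    · congr 2
      -- Away from the apex, the missing coordinate of the base point is `1 - ∑ j, t j.succ / s = t
      -- 0 / s`, where `s` is the sum of all `t i`.
      funext i
      refine Fin.cases ?_ (fun j => ?_) i
      · simp only [bary, Fin.cons_succ, Fin.cons_zero, ← Finset.sum_div]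
        rw [eq_sub_iff_add_eq, ← add_div, Fin.sum_univ_succ, div_self]
        rwa [← Fin.sum_univ_succ]
      · simp [bary]

theorem LieSuperalgebra.IsNilpotent.natSmooth_vertices (h𝔥 : 𝔥.IsNilpotent) (k : Fin (p + 1)) :
    𝔥.NatSmooth p fun n h => 𝔥.vertices n h k := by
  induction k using Fin.induction with
  | zero => exact .zero
  | succ i ih => exact h𝔥.natSmooth_expMul ih (.proj i)

theorem EvenCochain.isSupergroupCochain_int (h𝔥 : 𝔥.IsNilpotent) {ℓ : ℝ → ℝ}
    (hℓ : IsSmoothingFactor ℓ) (ω : EvenCochain 𝔥 p) :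
    IsSupergroupCochain 𝔥 p fun n => ω.int ℓ n :=
  ω.isSupergroupCochain_integral h𝔥
    ((h𝔥.separated_simplex hℓ p).comp_natSmooth h𝔥.natSmooth_vertices)

end

section

variable {V : Type*} [AddCommGroup V] [Module ℝ V] {𝔥 : LieSuperalgebra V} {p : ℕ}

/-! ### Equivariance under linear automorphisms -/

/-- Linearity handles the inverse `-h` and the contraction by `ℓ`; multiplicativity handles the
translations. -/
theorem LieSuperalgebra.simplex_map {n : ℕ} {φ : 𝔥.Pts n →ₗ[ℝ] 𝔥.Pts n}
    (hφ : ∀ x y, φ (𝔥.expMul n x y) = 𝔥.expMul n (φ x) (φ y)) (ℓ : ℝ → ℝ) (p : ℕ)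
    (h : Fin (p + 1) → 𝔥.Pts n) (x : Fin (p + 1) → ℝ) :
    𝔥.simplex n ℓ p (fun i => φ (h i)) x = φ (𝔥.simplex n ℓ p h x) := by
  induction p with
  | zero => rfl
  | succ p ih =>
    rw [LieSuperalgebra.simplex, LieSuperalgebra.simplex, hφ, map_smul, ← ih]
    simp only [hφ, LieSuperalgebra.expInv, map_neg]

theorem LieSuperalgebra.vertices_map {n : ℕ} {φ : 𝔥.Pts n →ₗ[ℝ] 𝔥.Pts n}
    (hφ : ∀ x y, φ (𝔥.expMul n x y) = 𝔥.expMul n (φ x) (φ y)) (h : Fin p → 𝔥.Pts n)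
    (k : Fin (p + 1)) : 𝔥.vertices n (fun i => φ (h i)) k = φ (𝔥.vertices n h k) := by
  induction k using Fin.induction with
  | zero => exact (map_zero φ).symm
  | succ i ih =>
    change 𝔥.expMul n (𝔥.vertices n (fun i => φ (h i)) i.castSucc) (φ (h i)) =
      φ (𝔥.expMul n (𝔥.vertices n h i.castSucc) (h i))
    rw [ih, hφ]

variable [FiniteDimensional ℝ V]

namespace EvenCochain

/-- An automorphism intertwines left translation by `h⁻¹` with left translation by `φ(h)⁻¹`.
Differentiating this at `h` moves `φ` inside the arguments of `ω_A`, where invariance removes it. -/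
theorem form_map (h𝔥 : 𝔥.IsNilpotent) (ω : EvenCochain 𝔥 p) {n : ℕ} {φ : 𝔥.Pts n →L[ℝ] 𝔥.Pts n}
    (hφ : ∀ x y, φ (𝔥.expMul n x y) = 𝔥.expMul n (φ x) (φ y))
    (hω : ∀ x : Fin p → 𝔥.Pts n, ω.onPts n (fun i => φ (x i)) = ω.onPts n x)
    (h : 𝔥.Pts n) (v : Fin p → 𝔥.Pts n) :
    ω.form n (φ h) (fun i => φ (v i)) = ω.form n h v := by
  rw [EvenCochain.form, EvenCochain.form,
    ← hω fun i => fderiv ℝ (fun k => 𝔥.expMul n (𝔥.expInv n h) k) h (v i)]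
  congr 1
  funext i
  have h1 : HasFDerivAt (fun k => 𝔥.expMul n (𝔥.expInv n (φ h)) (φ k))
      ((fderiv ℝ (fun k => 𝔥.expMul n (𝔥.expInv n (φ h)) k) (φ h)).comp φ) h :=
    (h𝔥.differentiable_expMul n _ (φ h)).hasFDerivAt.comp h φ.hasFDerivAt
  have h2 : HasFDerivAt (fun k => φ (𝔥.expMul n (𝔥.expInv n h) k))
      (φ.comp (fderiv ℝ (fun k => 𝔥.expMul n (𝔥.expInv n h) k) h)) h :=
    φ.hasFDerivAt.comp h (h𝔥.differentiable_expMul n _ h).hasFDerivAt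
  have h3 : (fun k => φ (𝔥.expMul n (𝔥.expInv n h) k)) =
      fun k => 𝔥.expMul n (𝔥.expInv n (φ h)) (φ k) := by
    funext k
    rw [hφ, LieSuperalgebra.expInv, LieSuperalgebra.expInv, map_neg]
  rw [h3] at h2
  exact DFunLike.congr_fun (h1.unique h2) (v i)

/-- Both simplices are parametrized by the same corner, and since `φ` is linear it is its own
derivative; the integrands agree pointwise by `form_map`. -/
theorem integral_map (h𝔥 : 𝔥.IsNilpotent) (ω : EvenCochain 𝔥 p) {n : ℕ}
    {φ : 𝔥.Pts n →L[ℝ] 𝔥.Pts n}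
    (hφ : ∀ x y, φ (𝔥.expMul n x y) = 𝔥.expMul n (φ x) (φ y))
    (hω : ∀ x : Fin p → 𝔥.Pts n, ω.onPts n (fun i => φ (x i)) = ω.onPts n x)
    {S : (Fin (p + 1) → ℝ) → 𝔥.Pts n} (hS : DifferentiableOn ℝ (fun t => S (bary t)) (corner p)) :
    ω.integral n (fun x => φ (S x)) = ω.integral n S := by
  refine MeasureTheory.setIntegral_congr_fun (isClosed_corner p).measurableSet fun t ht => ?_
  beta_reduce
  have h1 : fderivWithin ℝ (fun s => φ (S (bary s))) (corner p) t =
      φ.comp (fderivWithin ℝ (fun s => S (bary s)) (corner p) t) :=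
    (φ.hasFDerivAt.comp_hasFDerivWithinAt t (hS t ht).hasFDerivWithinAt).fderivWithin
      (uniqueDiffOn_corner p t ht)
  rw [h1]
  exact ω.form_map h𝔥 hφ hω _ _

theorem intHom_map (h𝔥 : 𝔥.IsNilpotent) {ℓ : ℝ → ℝ} (hℓ : IsSmoothingFactor ℓ)
    (ω : EvenCochain 𝔥 p) {n : ℕ} {φ : 𝔥.Pts n →L[ℝ] 𝔥.Pts n}
    (hφ : ∀ x y, φ (𝔥.expMul n x y) = 𝔥.expMul n (φ x) (φ y))
    (hω : ∀ x : Fin p → 𝔥.Pts n, ω.onPts n (fun i => φ (x i)) = ω.onPts n x)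
    (h : Fin (p + 1) → 𝔥.Pts n) : ω.intHom ℓ n (fun i => φ (h i)) = ω.intHom ℓ n h := by
  rw [EvenCochain.intHom, EvenCochain.intHom,
    ← ω.integral_map h𝔥 hφ hω ((h𝔥.separated_simplex hℓ p).differentiableOn n h)]
  congr 1
  funext x
  exact LieSuperalgebra.simplex_map (φ := φ.toLinearMap) hφ ℓ p h x

theorem int_map (h𝔥 : 𝔥.IsNilpotent) {ℓ : ℝ → ℝ} (hℓ : IsSmoothingFactor ℓ)
    (ω : EvenCochain 𝔥 p) {n : ℕ} {φ : 𝔥.Pts n →L[ℝ] 𝔥.Pts n}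
    (hφ : ∀ x y, φ (𝔥.expMul n x y) = 𝔥.expMul n (φ x) (φ y))
    (hω : ∀ x : Fin p → 𝔥.Pts n, ω.onPts n (fun i => φ (x i)) = ω.onPts n x)
    (h : Fin p → 𝔥.Pts n) : ω.int ℓ n (fun i => φ (h i)) = ω.int ℓ n h := by
  rw [EvenCochain.int, EvenCochain.int, ← ω.intHom_map h𝔥 hℓ hφ hω (𝔥.vertices n h)]
  congr 1
  funext k
  exact LieSuperalgebra.vertices_map (φ := φ.toLinearMap) hφ h k

end EvenCochain

/-! ### Actions by automorphisms are linear -/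

section Action

variable {W : Type*} [AddCommGroup W] [Module ℝ W] [FiniteDimensional ℝ W] {𝒲 : SuperVect W}
  {G : LieSupergroup 𝒲} (α : SupergroupAction G 𝔥)

namespace SupergroupAction

/-- Joint smoothness in a chart around `g` is restricted to the slice over `g`. -/
theorem differentiable_act (n : ℕ) (g : G.Pt n) : Differentiable ℝ (α.act n g) := by
  obtain ⟨i, z, hz, rfl⟩ := G.cover n g
  have h := ((α.smooth n i).1.differentiableOn (by simp)).comp
    (f := fun k : 𝔥.Pts n => (z, k)) (s := Set.univ)
    ((differentiable_const z).prodMk differentiable_id).differentiableOn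
    fun k _ => ⟨hz, trivial⟩
  exact differentiableOn_univ.1 h

/-- The image `a` of the identity is idempotent, while the product of `a` with itself is `2 a`;
hence `a = 2 a`. -/
theorem act_zero (n : ℕ) (g : G.Pt n) : α.act n g 0 = 0 := by
  have h0 : 𝔥.expMul n 0 0 = 0 := by
    simpa using LieSuperalgebra.expMul_smul_smul (𝔥 := 𝔥) 1 1 (0 : 𝔥.Pts n)
  have h1 := α.act_mul n g 0 0
  have h2 := LieSuperalgebra.expMul_smul_smul 1 1 (α.act n g 0)
  rw [one_smul] at h2
  rw [h0, h2, add_smul, one_smul] at h1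
  exact left_eq_add.1 h1

theorem act_natCast_smul (n : ℕ) (g : G.Pt n) (m : ℕ) (X : 𝔥.Pts n) :
    α.act n g ((m : ℝ) • X) = (m : ℝ) • α.act n g X := by
  induction m with
  | zero => simpa using α.act_zero n g
  | succ m ih =>
    have h1 := LieSuperalgebra.expMul_smul_smul (m : ℝ) 1 X
    have h2 := LieSuperalgebra.expMul_smul_smul (m : ℝ) 1 (α.act n g X)
    rw [Nat.cast_succ, ← h1, α.act_mul, ih, ← h2, one_smul, one_smul]

/-- By homogeneity over the natural numbers, `m` times the image of `X / m` does not depend on `m >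
0`. It also tends to the derivative at `0` applied to `X`. -/
theorem act_eq_Ad (n : ℕ) (g : G.Pt n) (X : 𝔥.Pts n) : α.act n g X = α.Ad n g X := by
  have h := (α.differentiable_act n g 0).hasFDerivAt.lim X (c := fun m : ℕ => (m : ℝ))
    (l := Filter.atTop) (by simpa using tendsto_natCast_atTop_atTop)
  refine tendsto_nhds_unique (tendsto_const_nhds.congr' ?_) h
  filter_upwards [Filter.eventually_gt_atTop 0] with m hm
  rw [zero_add, α.act_zero, sub_zero, ← act_natCast_smul, smul_inv_smul₀]
  exact_mod_cast hm.ne'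

theorem Ad_expMul (n : ℕ) (g : G.Pt n) (x y : 𝔥.Pts n) :
    α.Ad n g (𝔥.expMul n x y) = 𝔥.expMul n (α.Ad n g x) (α.Ad n g y) := by
  simp only [← act_eq_Ad, α.act_mul]

end SupergroupAction

end Action

end

namespace NormedDivisionAlgebra

variable {K : Type*} [NormedAddCommGroup K] [InnerProductSpace ℝ K] (D : NormedDivisionAlgebra K)

/-! ### Composition algebra identities -/

/-- Polarization of the norm identity in the second factor; `inner_mul_mul_add` polarizes the first
factor as well. -/
theorem inner_mul_mul_left (a b c : K) :
    inner ℝ (D.mul a b) (D.mul a c) = ‖a‖ ^ 2 * inner ℝ b c := by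
  have h := D.norm_mul a (b + c)
  have h2 : ‖D.mul a b + D.mul a c‖ ^ 2 = ‖a‖ ^ 2 * ‖b + c‖ ^ 2 := by
    rw [← map_add, h, mul_pow]
  rw [norm_add_sq_real, norm_add_sq_real, D.norm_mul, D.norm_mul] at h2
  linarith

theorem inner_mul_mul_add (a b c d : K) :
    inner ℝ (D.mul a b) (D.mul d c) + inner ℝ (D.mul d b) (D.mul a c) =
      2 * inner ℝ a d * inner ℝ b c := by
  have h := D.inner_mul_mul_left (a + d) b c
  rw [map_add, LinearMap.add_apply, LinearMap.add_apply, inner_add_left, inner_add_right,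
    inner_add_right, D.inner_mul_mul_left, D.inner_mul_mul_left, norm_add_sq_real] at h
  linarith

theorem norm_one : ‖D.one‖ = 1 := by
  have h := D.norm_mul D.one D.one
  rw [D.one_mul] at h
  exact (mul_eq_left₀ (norm_ne_zero_iff.2 D.one_ne_zero)).1 h.symm

/-- The doubly polarized norm identity with one left factor equal to `1`: multiplication by `a*` is
adjoint to multiplication by `a`. -/
theorem inner_mul_left (a b c : K) : inner ℝ (D.mul a b) c = inner ℝ b (D.mul (D.conj a) c) := by
  have h := D.inner_mul_mul_add a b c D.one
  rw [D.one_mul, D.one_mul] at h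
  rw [conj_apply, map_sub, map_smul, LinearMap.sub_apply, LinearMap.smul_apply, D.one_mul,
    inner_sub_right, inner_smul_right, real_inner_comm a D.one]
  linarith

theorem inner_mul_right (a b c : K) : inner ℝ (D.mul a b) c = inner ℝ a (D.mul c (D.conj b)) := by
  have h := D.inner_mul_mul_add a b D.one c
  rw [D.mul_one, D.mul_one] at h
  rw [conj_apply, map_sub, map_smul, D.mul_one, inner_sub_right, inner_smul_right,
    real_inner_comm b D.one, real_inner_comm (D.mul c b) a]
  linarith

theorem conj_conj (a : K) : D.conj (D.conj a) = a := by
  rw [D.conj_apply (D.conj a), D.conj_apply a, inner_sub_right, inner_smul_right,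
    real_inner_self_eq_norm_sq, D.norm_one]
  module

/-- The substitute for associativity, which fails for the octonions. Testing against `c` and using
adjointness reduces it to the polarized norm identity. -/
theorem conj_mul_mul (a b : K) : D.mul (D.conj a) (D.mul a b) = ‖a‖ ^ 2 • b := by
  refine ext_inner_left ℝ fun c => ?_
  rw [← inner_mul_left, inner_mul_mul_left, inner_smul_right]

theorem norm_conj (a : K) : ‖D.conj a‖ = ‖a‖ := by
  have h : ‖D.conj a‖ ^ 2 = ‖a‖ ^ 2 := by
    rw [conj_apply, norm_sub_sq_real, norm_smul, inner_smul_left, D.norm_one, mul_pow,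
      Real.norm_eq_abs, sq_abs]
    simp
    ring
  exact (sq_eq_sq₀ (norm_nonneg _) (norm_nonneg _)).1 h

theorem mul_conj_mul (a b : K) : D.mul a (D.mul (D.conj a) b) = ‖a‖ ^ 2 • b := by
  have h := D.conj_mul_mul (D.conj a) b
  rwa [conj_conj, norm_conj] at h

/-! ### The spinor representation -/

theorem minkowski_apply (A B : Vec K) :
    minkowski A B = -(A.1 * B.1) + A.2.1 * B.2.1 + inner ℝ A.2.2 B.2.2 := rfl

theorem minkowski_comm (A B : Vec K) : minkowski A B = minkowski B A := by
  rw [minkowski_apply, minkowski_apply, real_inner_comm]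
  ring

/-- Nondegeneracy: pairing the difference `Z` with its time reflection gives a sum of squares. -/
theorem minkowski_ext {X Y : Vec K} (h : ∀ C, minkowski C X = minkowski C Y) : X = Y := by
  rw [← sub_eq_zero]
  set Z := X - Y with hZ
  have h0 : minkowski (-Z.1, Z.2) Z = 0 := by rw [hZ, map_sub, ← hZ, h, sub_self]
  rw [minkowski_apply, real_inner_self_eq_norm_sq] at h0
  simp only at h0
  have h1 : Z.1 = 0 := by nlinarith [sq_nonneg Z.1, sq_nonneg Z.2.1, sq_nonneg ‖Z.2.2‖]
  have h2 : Z.2.1 = 0 := by nlinarith [sq_nonneg Z.1, sq_nonneg Z.2.1, sq_nonneg ‖Z.2.2‖]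
  have h3 : ‖Z.2.2‖ = 0 := by nlinarith [sq_nonneg Z.1, sq_nonneg Z.2.1, sq_nonneg ‖Z.2.2‖]
  exact Prod.ext h1 (Prod.ext h2 (norm_eq_zero.1 h3))

/-- The inner product of spinors. -/
def spinorInner (ψ φ : Spinor K) : ℝ := inner ℝ ψ.1 φ.1 + inner ℝ ψ.2 φ.2

theorem spinorInner_smul_right (r : ℝ) (ψ φ : Spinor K) :
    spinorInner ψ (r • φ) = r * spinorInner ψ φ := by
  simp only [spinorInner, Prod.smul_fst, Prod.smul_snd, inner_smul_right]
  ring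

theorem spinorInner_comm (ψ φ : Spinor K) : spinorInner ψ φ = spinorInner φ ψ := by
  simp only [spinorInner, real_inner_comm]

theorem gammaPlus_apply (A : Vec K) (ψ : Spinor K) : D.gammaPlus A ψ =
    ((A.1 + A.2.1) • ψ.1 + D.mul (D.conj A.2.2) ψ.2, D.mul A.2.2 ψ.1 + (A.1 - A.2.1) • ψ.2) := rfl

/-- This exhibits the bracket of spinors as adjoint to the action of vectors, so its equivariance
becomes a question about the operators `gammaPlus` and `gammaMinus`. -/
theorem minkowski_dot (A : Vec K) (ψ φ : Spinor K) :
    minkowski A (D.dot ψ φ) = spinorInner ψ (D.gammaPlus A φ) := by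
  simp only [minkowski_apply, dot, LinearMap.mk₂_apply, spinorInner, gammaPlus_apply,
    inner_add_right, inner_smul_right, ← inner_mul_right, ← inner_mul_left]
  rw [real_inner_comm ψ.2 (D.mul A.2.2 φ.1)]
  ring

theorem spinorInner_gammaPlus (A : Vec K) (ψ φ : Spinor K) :
    spinorInner (D.gammaPlus A ψ) φ = spinorInner ψ (D.gammaPlus A φ) := by
  rw [spinorInner_comm, ← minkowski_dot, ← minkowski_dot, dot_comm]

theorem spinorInner_gammaMinus (A : Vec K) (ψ φ : Spinor K) :
    spinorInner (D.gammaMinus A ψ) φ = spinorInner ψ (D.gammaMinus A φ) :=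
  D.spinorInner_gammaPlus _ ψ φ

theorem gammaPlus_add (A B : Vec K) (ψ : Spinor K) :
    D.gammaPlus (A + B) ψ = D.gammaPlus A ψ + D.gammaPlus B ψ := by
  simp only [gammaPlus_apply, Prod.fst_add, Prod.snd_add, map_add, LinearMap.add_apply, Prod.mk_add_mk]
  ext
  · module
  · module

theorem gammaPlus_smul (r : ℝ) (A : Vec K) (ψ : Spinor K) :
    D.gammaPlus (r • A) ψ = r • D.gammaPlus A ψ := by
  simp only [gammaPlus_apply, Prod.smul_fst, Prod.smul_snd, map_smul, LinearMap.smul_apply,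
    Prod.smul_mk, smul_eq_mul]
  ext
  · module
  · module

theorem gammaMinus_add (A B : Vec K) (ψ : Spinor K) :
    D.gammaMinus (A + B) ψ = D.gammaMinus A ψ + D.gammaMinus B ψ := by
  rw [gammaMinus, gammaMinus, gammaMinus, ← gammaPlus_add]
  congr 2
  ext <;> simp [add_comm]

theorem gammaMinus_smul (r : ℝ) (A : Vec K) (ψ : Spinor K) :
    D.gammaMinus (r • A) ψ = r • D.gammaMinus A ψ := by
  rw [gammaMinus, gammaMinus, ← gammaPlus_smul]
  congr 2
  ext <;> simp

/-- The Clifford relation. The off-diagonal terms cancel, and the diagonal ones need only `a* (a b)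
= ‖a‖² b` and `a (a* b) = ‖a‖² b`. -/
theorem gammaMinus_gammaPlus_self (A : Vec K) (ψ : Spinor K) :
    D.gammaMinus A (D.gammaPlus A ψ) = minkowski A A • ψ := by
  simp only [gammaMinus, gammaPlus_apply, minkowski_apply, map_add, map_smul, conj_mul_mul,
    mul_conj_mul, real_inner_self_eq_norm_sq]
  ext
  · simp only [Prod.smul_fst]; module
  · simp only [Prod.smul_snd]; module

theorem gammaPlus_gammaMinus_self (A : Vec K) (ψ : Spinor K) :
    D.gammaPlus A (D.gammaMinus A ψ) = minkowski A A • ψ := by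
  simp only [gammaMinus, gammaPlus_apply, minkowski_apply, map_add, map_smul, conj_mul_mul,
    mul_conj_mul, real_inner_self_eq_norm_sq]
  ext
  · simp only [Prod.smul_fst]; module
  · simp only [Prod.smul_snd]; module

theorem minkowski_add_self (A B : Vec K) :
    minkowski (A + B) (A + B) = minkowski A A + minkowski B B + 2 * minkowski A B := by
  simp only [map_add, LinearMap.add_apply, minkowski_comm B A]
  ring

theorem gammaMinus_gammaPlus_add (A C : Vec K) (ψ : Spinor K) :
    D.gammaMinus A (D.gammaPlus C ψ) + D.gammaMinus C (D.gammaPlus A ψ) =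
      (2 * minkowski A C) • ψ := by
  have h := D.gammaMinus_gammaPlus_self (A + C) ψ
  rw [gammaPlus_add, gammaMinus_add, map_add, map_add, gammaMinus_gammaPlus_self,
    gammaMinus_gammaPlus_self, minkowski_add_self, add_smul, add_smul] at h
  linear_combination (norm := module) h

theorem gammaPlus_gammaMinus_add (A C : Vec K) (ψ : Spinor K) :
    D.gammaPlus A (D.gammaMinus C ψ) + D.gammaPlus C (D.gammaMinus A ψ) =
      (2 * minkowski A C) • ψ := by
  have h := D.gammaPlus_gammaMinus_self (A + C) ψ
  rw [gammaMinus_add, gammaPlus_add, map_add, map_add, gammaPlus_gammaMinus_self,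
    gammaPlus_gammaMinus_self, minkowski_add_self, add_smul, add_smul] at h
  linear_combination (norm := module) h

theorem conjVec_apply (B C : Vec K) :
    conjVec B C = (2 / minkowski B B * minkowski B C) • B - C := by
  simp [conjVec, mul_smul]

theorem smul_conjVec {B : Vec K} (hB : minkowski B B ≠ 0) (C : Vec K) :
    (2 * minkowski B C) • B = minkowski B B • (conjVec B C + C) := by
  rw [conjVec_apply, sub_add_cancel, smul_smul]
  congr 1
  field_simp

theorem minkowski_conjVec (B X Y : Vec K) :
    minkowski (conjVec B X) Y = minkowski X (conjVec B Y) := by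
  simp only [conjVec_apply, map_sub, map_smul, LinearMap.sub_apply, LinearMap.smul_apply, smul_eq_mul,
    minkowski_comm X B]
  ring

theorem minkowski_conjVec_conjVec {B : Vec K} (hB : minkowski B B ≠ 0) (X Y : Vec K) :
    minkowski (conjVec B X) (conjVec B Y) = minkowski X Y := by
  simp only [conjVec_apply, map_sub, map_smul, LinearMap.sub_apply, LinearMap.smul_apply, smul_eq_mul,
    minkowski_comm X B]
  field_simp
  ring

/-- The polarized Clifford relation applied to `Ã φ`, with `A Ã = g(A, A)` simplifying one of its
terms. -/
theorem gammaMinus_gammaPlus_gammaMinus {A : Vec K} (hA : minkowski A A ≠ 0) (C : Vec K)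
    (φ : Spinor K) : D.gammaMinus A (D.gammaPlus C (D.gammaMinus A φ)) =
      minkowski A A • D.gammaMinus (conjVec A C) φ := by
  have h := D.gammaMinus_gammaPlus_add A C (D.gammaMinus A φ)
  rw [gammaPlus_gammaMinus_self, map_smul, ← D.gammaMinus_smul (2 * minkowski A C), smul_conjVec hA,
    gammaMinus_smul,
    gammaMinus_add, smul_add] at h
  exact add_right_cancel h

theorem gammaPlus_gammaMinus_gammaPlus {A : Vec K} (hA : minkowski A A ≠ 0) (C : Vec K)
    (φ : Spinor K) : D.gammaPlus A (D.gammaMinus C (D.gammaPlus A φ)) =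
      minkowski A A • D.gammaPlus (conjVec A C) φ := by
  have h := D.gammaPlus_gammaMinus_add A C (D.gammaPlus A φ)
  rw [gammaMinus_gammaPlus_self, map_smul, ← D.gammaPlus_smul (2 * minkowski A C), smul_conjVec hA,
    gammaPlus_smul,
    gammaPlus_add, smul_add] at h
  exact add_right_cancel h

/-- Pairing with a vector `C` and moving the operators to one side gives `⟨ψ, B Ã C Ã B φ⟩`. This is
`g(A, A) g(B, B)` times the matrix element of `C` conjugated by `A` and then by `B`. The scalar is
`1` because the two squares are equal and of absolute value one. -/
theorem dot_gammaMinus_gammaPlus {A B : Vec K} (hAB : minkowski A A = minkowski B B)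
    (hA : |minkowski A A| = 1) (ψ φ : Spinor K) :
    D.dot (D.gammaMinus A (D.gammaPlus B ψ)) (D.gammaMinus A (D.gammaPlus B φ)) =
      conjVec A (conjVec B (D.dot ψ φ)) := by
  have h0 : minkowski A A ≠ 0 := by
    intro h
    rw [h, abs_zero] at hA
    exact zero_ne_one hA
  refine minkowski_ext fun C => ?_
  rw [minkowski_dot, spinorInner_gammaMinus, gammaMinus_gammaPlus_gammaMinus D h0,
    spinorInner_gammaPlus, map_smul, gammaPlus_gammaMinus_gammaPlus D (hAB ▸ h0),
    ← hAB, smul_smul, spinorInner_smul_right, ← minkowski_dot, minkowski_conjVec, minkowski_conjVec,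
    ← abs_mul_abs_self, hA, _root_.one_mul, _root_.one_mul]

variable [FiniteDimensional ℝ K]

theorem spin_invariance {u : (Vec K →L[ℝ] Vec K) × (Spinor K →L[ℝ] Spinor K)} (hu : u ∈ D.spin) :
    (∀ X Y, minkowski (u.1 X) (u.1 Y) = minkowski X Y) ∧
      ∀ ψ φ, D.dot (u.2 ψ) (u.2 φ) = u.1 (D.dot ψ φ) := by
  induction hu using Submonoid.closure_induction with
  | mem u hu =>
    obtain ⟨A, B, hAB, hA, rfl⟩ := hu
    have h0 : minkowski A A ≠ 0 := by
      intro h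
      rw [h, abs_zero] at hA
      exact zero_ne_one hA
    refine ⟨fun X Y => ?_, fun ψ φ => D.dot_gammaMinus_gammaPlus hAB hA ψ φ⟩
    exact (minkowski_conjVec_conjVec h0 _ _).trans (minkowski_conjVec_conjVec (hAB ▸ h0) X Y)
  | one => exact ⟨fun _ _ => rfl, fun _ _ => rfl⟩
  | mul u v _ _ hu hv =>
    refine ⟨fun X Y => ?_, fun ψ φ => ?_⟩
    · exact (hu.1 _ _).trans (hv.1 X Y)
    · exact (hu.2 _ _).trans (congrArg u.1 (hv.2 ψ φ))

end NormedDivisionAlgebra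

/-! ### Matrix coefficients with values in a Grassmann algebra -/

section MatrixCoefficients

variable {V : Type*} [AddCommGroup V] [Module ℝ V] {κ : Type*} [Fintype κ] {n : ℕ}
  {S : Type*} {C : Subalgebra ℝ (S → ℝ)} (χ : C →ₐ[ℝ] Gr0 n) (b : Module.Basis κ ℝ V)
  (M : κ → κ → C)

/-- The action on `A ⊗ V` of the matrix whose entries are the values at an `A`-point `χ` of the
functions `M i j`. -/
def coeffMap : Gr n ⊗[ℝ] V →ₗ[ℝ] Gr n ⊗[ℝ] V :=
  ∑ i, ∑ j, TensorProduct.map (LinearMap.mulLeft ℝ (χ (M i j) : Gr n)) ((b.coord j).smulRight (b i))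

variable {M} {ρ : S → V →ₗ[ℝ] V}

theorem coeffMap_tmul (a : Gr n) (v : V) :
    coeffMap χ b M (a ⊗ₜ v) =
      ∑ i, ((χ (∑ j, b.repr v j • M i j) : Gr n) * a) ⊗ₜ[ℝ] b i := by
  rw [coeffMap, LinearMap.sum_apply]
  refine Finset.sum_congr rfl fun i _ => ?_
  rw [LinearMap.sum_apply, map_sum]
  simp only [TensorProduct.map_tmul, LinearMap.smulRight_apply, LinearMap.mulLeft_apply,
    ← TensorProduct.smul_tmul, map_smul, AddSubmonoidClass.coe_finsetSum, Finset.sum_mul,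
    TensorProduct.sum_tmul]
  refine Finset.sum_congr rfl fun j _ => ?_
  rw [← smul_mul_assoc]
  rfl

variable (hM : ∀ i j s, (M i j : S → ℝ) s = b.repr (ρ s (b j)) i)
include hM

theorem coeff_eval (v : V) (i : κ) (s : S) :
    ((∑ j, b.repr v j • M i j : C) : S → ℝ) s = b.repr (ρ s v) i := by
  conv_rhs => rw [← b.sum_repr v, map_sum, map_sum, Finsupp.coe_finsetSum, Finset.sum_apply]
  simp [hM, Finset.sum_apply]

/-- Equivariance of all the `ρ s`, written in coordinates, is an identity between elements of the
function algebra `C`. It can be checked at each `s` and then transported by the homomorphism `χ`. -/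
theorem bracketAux_coeffMap (𝔥 : LieSuperalgebra V)
    (hρ : ∀ s v w, 𝔥.bracket (ρ s v) (ρ s w) = ρ s (𝔥.bracket v w)) (x y : Gr n ⊗[ℝ] V) :
    𝔥.bracketAux n (coeffMap χ b M x) (coeffMap χ b M y) = coeffMap χ b M (𝔥.bracketAux n x y) := by
  induction x using TensorProduct.induction_on with
  | zero => simp
  | add x z hx hz => simp only [map_add, LinearMap.add_apply, hx, hz]
  | tmul a v =>
    induction y using TensorProduct.induction_on with
    | zero => simp
    | add y z hy hz => simp only [map_add, hy, hz]
    | tmul a' w =>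
      rw [𝔥.bracketAux_tmul, coeffMap_tmul, coeffMap_tmul, coeffMap_tmul]
      have e1 := coeff_eval b hM v
      have e2 := coeff_eval b hM w
      -- `f` and `g` are the coordinates of the moving vectors `ρ s v` and `ρ s w`, as functions of
      -- `s`.
      generalize hf : (fun i => ∑ j, b.repr v j • M i j) = f
      generalize hg : (fun i => ∑ j, b.repr w j • M i j) = g
      replace hf := congrFun hf
      replace hg := congrFun hg
      simp only [hf] at e1 ⊢
      simp only [hg] at e2 ⊢
      have key : ∀ m, ∑ j, b.repr (𝔥.bracket v w) j • M m j =
          ∑ i, ∑ k, b.repr (𝔥.bracket (b i) (b k)) m • (g k * f i) := by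
        intro m
        refine Subtype.ext (funext fun s => ?_)
        rw [coeff_eval b hM, ← hρ, ← b.sum_repr (ρ s v), ← b.sum_repr (ρ s w)]
        simp only [map_sum, LinearMap.sum_apply, map_smul, LinearMap.smul_apply,
          Finsupp.coe_finsetSum, Finset.sum_apply, AddSubmonoidClass.coe_finsetSum,
          Finsupp.smul_apply, smul_eq_mul]
        rw [Finset.sum_comm]
        refine Finset.sum_congr rfl fun k _ => ?_
        rw [Finset.mul_sum]
        refine Finset.sum_congr rfl fun i _ => ?_
        change _ = b.repr (𝔥.bracket (b i) (b k)) m * ((g k : S → ℝ) s * (f i : S → ℝ) s)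
        rw [e1, e2]
        ring
      have expand : ∀ i k,
          𝔥.bracketAux n (((χ (f i) : Gr n) * a) ⊗ₜ b i) (((χ (g k) : Gr n) * a') ⊗ₜ b k) =
          ∑ m, ((χ (b.repr (𝔥.bracket (b i) (b k)) m • (g k * f i)) : Gr n) * (a' * a)) ⊗ₜ b m := by
        intro i k
        conv_lhs => rw [𝔥.bracketAux_tmul, ← b.sum_repr (𝔥.bracket (b i) (b k))]
        rw [TensorProduct.tmul_sum]
        refine Finset.sum_congr rfl fun m _ => ?_
        rw [← TensorProduct.smul_tmul, map_smul, map_mul]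
        congr 1
        change _ • _ = (_ • ((χ (g k) : Gr n) * (χ (f i) : Gr n))) * (a' * a)
        -- Values of `χ` are even, hence central, and can be collected in front of the coefficients
        -- `a' * a`.
        rw [smul_mul_assoc, mul_assoc, mul_assoc, ← mul_assoc a', ← gr0_commute, mul_assoc]
      rw [LinearMap.map_sum₂]
      simp only [map_sum (𝔥.bracketAux n _), expand, key]
      simp only [map_sum, AddSubmonoidClass.coe_finsetSum, Finset.sum_mul, TensorProduct.sum_tmul]
      refine Eq.symm (Finset.sum_comm.trans (Finset.sum_congr rfl fun i _ => ?_))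
      exact Finset.sum_comm

/-- The same transport, applied to invariance of `ω`: expanded in the basis it is a polynomial
identity of degree `p` in the matrix coefficients. -/
theorem ext_coeffMap [FiniteDimensional ℝ V] {𝔥 : LieSuperalgebra V} {p : ℕ} (ω : EvenCochain 𝔥 p)
    (hω : ∀ s v, ω.toMap (fun k => ρ s (v k)) = ω.toMap v) (x : Fin p → Gr n ⊗[ℝ] V) :
    ω.ext n (fun k => coeffMap χ b M (x k)) = ω.ext n x := by
  classical
  have H : ∀ (a : Fin p → Gr n) (v : Fin p → V),
      ω.ext n (fun k => coeffMap χ b M (a k ⊗ₜ v k)) = ω.ext n fun k => a k ⊗ₜ v k := by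
    intro a v
    set f : Fin p → κ → C := fun k i => ∑ j, b.repr (v k) j • M i j with hf
    have key : ∑ d : Fin p → κ, ω.toMap (fun k => b (d k)) • ∏ k, f k (d k) =
        algebraMap ℝ C (ω.toMap v) := by
      refine Subtype.ext (funext fun s => ?_)
      change _ = ω.toMap v
      rw [← hω s v]
      conv_rhs => rw [show (fun k => ρ s (v k)) = fun k => ∑ j, b.repr (ρ s (v k)) j • b j
        from funext fun k => (b.sum_repr _).symm]
      rw [MultilinearMap.map_sum]
      simp only [AddSubmonoidClass.coe_finsetSum, Finset.sum_apply]
      refine Finset.sum_congr rfl fun d _ => ?_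
      rw [MultilinearMap.map_smul_univ, smul_eq_mul, mul_comm]
      change ω.toMap (fun k => b (d k)) * ((∏ k, f k (d k) : C) : S → ℝ) s = _
      rw [SubmonoidClass.coe_finsetProd, Finset.prod_apply]
      congr 1
      exact Finset.prod_congr rfl fun k _ => coeff_eval b hM (v k) (d k) s
    have hprod : ∀ d : Fin p → κ, (List.ofFn fun k : Fin p =>
        (χ (f k.rev (d k.rev)) : Gr n) * a k.rev).prod =
        (χ (∏ k, f k (d k)) : Gr n) * (List.ofFn fun k : Fin p => a k.rev).prod := by
      intro d
      rw [gr_prod_ofFn_mul (fun k : Fin p => a k.rev) fun k => χ (f k.rev (d k.rev))]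
      congr 2
      -- The factors coming from `χ` appear in reversed order, which does not matter in the
      -- commutative ring `A₀`.
      let := gr0CommRing n
      rw [map_prod]
      exact Equiv.prod_comp Fin.revPerm fun k => χ (f k (d k))
    simp only [coeffMap_tmul]
    rw [MultilinearMap.map_sum]
    simp only [ω.ext_tmul]
    rw [Finset.sum_congr rfl fun d _ => congrArg _ (hprod d)]
    have h2 := congrArg (fun c => ((χ c : Gr0 n) : Gr n)) key
    simp only [map_sum, map_smul, AddSubmonoidClass.coe_finsetSum] at h2
    simp only [← smul_mul_assoc, ← Finset.sum_mul]
    refine Eq.trans (congrArg (· * _) h2) ?_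
    rw [AlgHom.commutes]
    exact (Algebra.smul_def _ _).symm
  -- Both sides are multilinear, so agreement on pure tensors of basis vectors suffices.
  have hm : (ω.ext n).compLinearMap (fun _ => coeffMap χ b M) = ω.ext n := by
    refine Module.Basis.ext_multilinear
      (fun _ => (Module.finBasis ℝ (Gr n)).tensorProduct b) fun d => ?_
    simp only [Module.Basis.tensorProduct_apply', MultilinearMap.compLinearMap_apply]
    exact H _ _
  exact congrArg (fun F => F x) hm

end MatrixCoefficients

/-! ### The action of `Spin(n+1, 1)` on the supertranslation group -/

namespace NormedDivisionAlgebra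

variable {K : Type*} [NormedAddCommGroup K] [InnerProductSpace ℝ K] (D : NormedDivisionAlgebra K)

/-- Brackets have no spinor component, and the bracket sees only spinor components, so double
brackets vanish. -/
theorem supertranslation_isNilpotent : D.supertranslation.IsNilpotent := by
  refine ⟨2, fun l x hl => ?_⟩
  obtain ⟨y, z, rfl⟩ := List.length_eq_two.1 hl
  change D.tBracket y (D.tBracket z x) = 0
  simp [tBracket_apply]

variable [FiniteDimensional ℝ K]

/-- The representation of `Spin(n+1, 1)` on `V ⊕ S₊`. -/
def spinRep (u : (D.spin : Set ((Vec K →L[ℝ] Vec K) × (Spinor K →L[ℝ] Spinor K)))) :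
    STrans K →ₗ[ℝ] STrans K :=
  (u.1.1 : Vec K →ₗ[ℝ] Vec K).prodMap (u.1.2 : Spinor K →ₗ[ℝ] Spinor K)

variable (K) in
/-- A basis of `V ⊕ S₊` adapted to the decomposition. -/
def stBasis : Module.Basis (Fin (Module.finrank ℝ (Vec K)) ⊕ Fin (Module.finrank ℝ (Spinor K))) ℝ
    (STrans K) :=
  (Module.finBasis ℝ (Vec K)).prod (Module.finBasis ℝ (Spinor K))

/-- The matrix coefficients of the representation on `V ⊕ S₊`. -/
def coeffST : Fin (Module.finrank ℝ (Vec K)) ⊕ Fin (Module.finrank ℝ (Spinor K)) →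
    Fin (Module.finrank ℝ (Vec K)) ⊕ Fin (Module.finrank ℝ (Spinor K)) →
    smoothFunctions (D.spin : Set ((Vec K →L[ℝ] Vec K) × (Spinor K →L[ℝ] Spinor K)))
  | .inl i, .inl j => D.coeffVec i j
  | .inr i, .inr j => D.coeffSpinor i j
  | .inl _, .inr _ => 0
  | .inr _, .inl _ => 0

theorem coeffST_apply (i j) (u : (D.spin : Set ((Vec K →L[ℝ] Vec K) × (Spinor K →L[ℝ] Spinor K)))) :
    (D.coeffST i j : _ → ℝ) u = (stBasis K).repr (D.spinRep u (stBasis K j)) i := by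
  rcases i with i | i <;> rcases j with j | j <;>
    simp [coeffST, stBasis, spinRep, coeffVec, coeffSpinor]

/-- In the adapted basis the representation is block diagonal, so the sums over the blocks `V` and
`S₊` make up a single matrix and the transport lemmas for `coeffMap` apply. -/
theorem incl_spinAct (n : ℕ) (χ : D.SpinPts n) (x : D.supertranslation.Pts n) :
    D.supertranslation.incl n (D.spinAct n χ x) =
      coeffMap χ (stBasis K) D.coeffST (D.supertranslation.incl n x) := by
  have h1 : ∀ i j, LinearMap.prodMap
      (((Module.finBasis ℝ (Vec K)).coord j).smulRight (Module.finBasis ℝ (Vec K) i))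
      (0 : Spinor K →ₗ[ℝ] Spinor K) =
      ((stBasis K).coord (.inl j)).smulRight (stBasis K (.inl i)) := by
    intro i j
    ext <;> simp [stBasis]
  have h2 : ∀ i j, LinearMap.prodMap (0 : Vec K →ₗ[ℝ] Vec K)
      (((Module.finBasis ℝ (Spinor K)).coord j).smulRight (Module.finBasis ℝ (Spinor K) i)) =
      ((stBasis K).coord (.inr j)).smulRight (stBasis K (.inr i)) := by
    intro i j
    ext <;> simp [stBasis]
  have h3 : ∀ (c : Gr0 n) (L : STrans K →ₗ[ℝ] STrans K) (y : Gr n ⊗[ℝ] STrans K),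
      TensorProduct.map (LinearMap.mulLeft ℝ (c : Gr n)) L y = c • LinearMap.lTensor (Gr n) L y := by
    intro c L y
    induction y using TensorProduct.induction_on with
    | zero => simp
    | add y z hy hz => rw [map_add, hy, hz, map_add, smul_add]
    | tmul a v => simp [gr0_smul_tmul]
  have h4 : ∀ (L : STrans K →ₗ[ℝ] STrans K) hL, D.supertranslation.incl n
      (D.supertranslation.linPts n L hL x) =
      LinearMap.lTensor (Gr n) L (D.supertranslation.incl n x) := fun _ _ => rfl
  simp only [spinAct, map_add, map_sum, SuperVect.incl_smul, h4, coeffMap, LinearMap.sum_apply,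
    LinearMap.add_apply, h3,
    Fintype.sum_sum_type, coeffST, map_zero, zero_smul, Finset.sum_const_zero, add_zero, zero_add,
    h1, h2]

/-- The action of an `A`-point of `Spin(n+1, 1)` as a linear map. -/
def spinActLin (n : ℕ) (χ : D.SpinPts n) :
    D.supertranslation.Pts n →L[ℝ] D.supertranslation.Pts n :=
  LinearMap.toContinuousLinearMap
    { toFun := D.spinAct n χ
      map_add' := fun x y => D.supertranslation.incl_injective n (by simp only [incl_spinAct, map_add])
      map_smul' := fun r x => D.supertranslation.incl_injective n (by
        simp only [incl_spinAct, map_smul, RingHom.id_apply]) }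

theorem spinActLin_apply (n : ℕ) (χ : D.SpinPts n) (x : D.supertranslation.Pts n) :
    D.spinActLin n χ x = D.spinAct n χ x := rfl

theorem spinAct_bracketPts (n : ℕ) (χ : D.SpinPts n) (x y : D.supertranslation.Pts n) :
    D.spinAct n χ (D.supertranslation.bracketPts n x y) =
      D.supertranslation.bracketPts n (D.spinAct n χ x) (D.spinAct n χ y) := by
  apply D.supertranslation.incl_injective n
  change _ = D.supertranslation.bracketAux n (D.supertranslation.incl n _)
    (D.supertranslation.incl n _)
  rw [incl_spinAct, incl_spinAct, incl_spinAct, bracketAux_coeffMap χ (stBasis K) D.coeffST_apply]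
  · rfl
  · intro u v w
    exact Prod.ext ((D.spin_invariance u.2).2 v.2 w.2) (map_zero u.1.2).symm

theorem spinActLin_expMul (n : ℕ) (χ : D.SpinPts n) (x y : D.supertranslation.Pts n) :
    D.spinActLin n χ (D.supertranslation.expMul n x y) =
      D.supertranslation.expMul n (D.spinActLin n χ x) (D.spinActLin n χ y) :=
  D.supertranslation_isNilpotent.map_expMul (φ := (D.spinActLin n χ).toLinearMap)
    (D.spinAct_bracketPts n χ) x y

/-- `α` is built from the Minkowski product and the bracket of spinors, both compatible with every
element of the group. -/
theorem alpha_onPts_spinActLin (n : ℕ) (χ : D.SpinPts n) (x : Fin 3 → D.supertranslation.Pts n) :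
    D.alpha.onPts n (fun i => D.spinActLin n χ (x i)) = D.alpha.onPts n x := by
  apply Subtype.ext
  simp only [EvenCochain.onPts, spinActLin_apply, incl_spinAct]
  refine ext_coeffMap χ (stBasis K) D.coeffST_apply D.alpha (fun u v => ?_) _
  have h := D.spin_invariance u.2
  change D.alphaMap _ = D.alphaMap _
  rw [alphaMap_apply, alphaMap_apply]
  simp only [spinRep, LinearMap.prodMap_apply, ContinuousLinearMap.coe_coe, h.1, h.2]

end NormedDivisionAlgebra

end Super

/-! ### Equivariance and invariance of the integrated cochains -/

theorem mainTheorem6 (ℓ : ℝ → ℝ) (hℓ : Super.IsSmoothingFactor ℓ) :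
    (∀ (V : Type*) [AddCommGroup V] [Module ℝ V] [FiniteDimensional ℝ V]
        (𝔥 : Super.LieSuperalgebra V) (_ : 𝔥.IsNilpotent)
        (W : Type*) [AddCommGroup W] [Module ℝ W] [FiniteDimensional ℝ W]
        (𝒲 : Super.SuperVect W) (G : Super.LieSupergroup 𝒲) (α : Super.SupergroupAction G 𝔥),
      (∀ (q n : ℕ) (g : G.Pt n) (h : Fin (q + 1) → 𝔥.Pts n),
        ∀ x ∈ stdSimplex ℝ (Fin (q + 1)),
          𝔥.simplex n ℓ q (fun i => α.act n g (h i)) x = α.act n g (𝔥.simplex n ℓ q h x)) ∧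
      ∀ (p : ℕ) (ω : Super.EvenCochain 𝔥 p), ω.IsInvariant α →
        Super.IsSupergroupCochain 𝔥 p (fun n => ω.int ℓ n) ∧
        (∀ (n : ℕ) (g : G.Pt n) (h : Fin p → 𝔥.Pts n),
          ω.int ℓ n (fun i => α.act n g (h i)) = ω.int ℓ n h) ∧
        (∀ (n : ℕ) (g : G.Pt n) (h : Fin (p + 1) → 𝔥.Pts n),
          ω.intHom ℓ n (fun i => α.act n g (h i)) = ω.intHom ℓ n h)) ∧
    (∀ (K : Type*) [NormedAddCommGroup K] [InnerProductSpace ℝ K] [FiniteDimensional ℝ K]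
        (D : Super.NormedDivisionAlgebra K),
      Super.IsSupergroupCochain D.supertranslation 3 (fun n => D.alpha.int ℓ n) ∧
      (∀ (n : ℕ) (χ : D.SpinPts n) (h : Fin 3 → D.supertranslation.Pts n),
        D.alpha.int ℓ n (fun i => D.spinAct n χ (h i)) = D.alpha.int ℓ n h) ∧
      (∀ (n : ℕ) (χ : D.SpinPts n) (h : Fin 4 → D.supertranslation.Pts n),
        D.alpha.intHom ℓ n (fun i => D.spinAct n χ (h i)) = D.alpha.intHom ℓ n h)) := by
  refine ⟨fun V _ _ _ 𝔥 h𝔥 W _ _ _ 𝒲 G α => ⟨fun q n g h x _ => ?_, fun p ω hω =>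
    ⟨ω.isSupergroupCochain_int h𝔥 hℓ, fun n g h => ?_, fun n g h => ?_⟩⟩, fun K _ _ _ D =>
    ⟨D.alpha.isSupergroupCochain_int D.supertranslation_isNilpotent hℓ, fun n χ h => ?_,
      fun n χ h => ?_⟩⟩
  -- Replacing the action by its derivative makes it a linear map, as the transformation lemmas
  -- require.
  · simp only [α.act_eq_Ad]
    exact Super.LieSuperalgebra.simplex_map (φ := (α.Ad n g).toLinearMap) (α.Ad_expMul n g) ℓ q h x
  · simp only [α.act_eq_Ad]
    exact ω.int_map h𝔥 hℓ (α.Ad_expMul n g) (hω n g) h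
  · simp only [α.act_eq_Ad]
    exact ω.intHom_map h𝔥 hℓ (α.Ad_expMul n g) (hω n g) h
  · exact D.alpha.int_map D.supertranslation_isNilpotent hℓ (D.spinActLin_expMul n χ)
      (D.alpha_onPts_spinActLin n χ) h
  · exact D.alpha.intHom_map D.supertranslation_isNilpotent hℓ (D.spinActLin_expMul n χ)
      (D.alpha_onPts_spinActLin n χ) h
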